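/- Let $\zeta$ be the Riemann zeta function. The integral $$\int_0^\infty \frac{\ln|\zeta(1/2+it)|}{\cosh(\pi t)}\,dt$$ and the series $\sum_{n=2}^{\infty}(-1)^{n+1}\ln\zeta(n)$ converge absolutely, and the equality $$\int_0^\infty \frac{\ln|\zeta(1/2+it)|}{\cosh(\pi t)}\,dt=\ln\frac{\pi}{2}+\sum_{n=2}^{\infty}(-1)^{n+1}\ln\zeta(n)$$ holds if and only if the Riemann hypothesis is true, that is, if and only if every zero of $\zeta$ other than the trivial zeros $-2,-4,-6,\dots$ has real part $1/2$. -/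

import Mathlib

/-!
The harmonic measure of the strip `|Re z| < 1 / 2` seen from its centre has density
`1 / (2 cosh (π t))` on each of the two edges. Jensen's inequality therefore says that, for `f`
analytic on the closed strip with `f 0 ≠ 0` and `log ‖f‖` of at most linear growth, `2 log ‖f 0‖`
is at most the sum of the integrals of `log ‖f‖ / cosh (π t)` over the edges (`strip_jensen`),
strictly so if `f` has a zero inside (`strip_jensen_strict`), with equality if `1 / f` is
analytic and of the same growth (`strip_mean_value`). Write `J σ` for the integral
of `log ‖ζ(σ + i t)‖ / cosh (π t)` over `ℝ`, and `J₁ σ` for the same integral with the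
entire function `(s - 1) ζ(s)` in place of `ζ`.

For integers `n ≥ 2` the mean value property of `log ‖ζ‖` reads
`J (n - 1 / 2) + J (n + 1 / 2) = 2 log ζ(n)`. As `J` tends to `0` at infinity, twice the
alternating sum telescopes to `-J (3 / 2)` (`two_mul_tsum_log_riemannZeta`). On both edges of the
strip `1 / 2 ≤ Re s ≤ 3 / 2` one has `|s - 1| = |1 / 2 + i t|`, and the mean value property of
`tan (π z / 2) / z`, whose numerator has modulus `1` on the edges, evaluates the contribution of
that factor: `J = J₁ + log (π / 2)` on both lines (`integral_log_norm_half_line`). The integral in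
question is `J (1 / 2) / 2`, so the asserted equality amounts to `J₁ (1 / 2) + J₁ (3 / 2) = 0`.

The function `(s - 1) ζ(s)` takes the value `1` at `s = 1`. Hence Jensen's inequality gives
`J₁ (1 / 2) + J₁ (3 / 2) ≥ 0`, and the inequality is strict when `ζ` has a zero with
`1 / 2 < Re s < 1`, as it does, by the functional equation, when the Riemann hypothesis fails.
If the hypothesis holds, the reverse inequality comes from Jensen's inequality for
`1 / ((s - 1) ζ(s))` in the strips `1 / 2 + ε ≤ Re s ≤ 3 / 2 + ε`, where the Borel–Carathéodory
theorem supplies the growth bound (`exists_inv_riemannZeta₁_growth`). In the limit `ε → 0` only the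
lower semicontinuity of `J₁` is needed (`eventually_zeta₁LineIntegral_ge`): locally it holds because
moving to the right of a line leads away from the zeros on it, and the tails are uniformly small by
Jensen's inequality in a strip of width `2`, which bounds the integral against the heavier weight
`1 / cosh (π t / 2)`.
-/

open Complex MeasureTheory Set Filter Topology Metric
open scoped Real

/-! ### The conformal map from the unit disc to the strip -/

/-- The conformal map `w ↦ (2 / π) * arctan w` of the open unit disc onto the open strip
`|Re z| < 1 / 2`, written through the logarithm. It sends `0` to `0`. -/
noncomputable def stripMap (w : ℂ) : ℂ := log ((1 + I * w) / (1 - I * w)) / (I * π)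

/-- The parametrization of the open right half of the unit circle that `stripMap` turns into
`t ↦ 1 / 2 + t * I`. -/
noncomputable def circlePt (t : ℝ) : ℂ :=
  ((1 / Real.cosh (π * t) : ℝ) : ℂ) + ((Real.sinh (π * t) / Real.cosh (π * t) : ℝ) : ℂ) * I

lemma circlePt_re (t : ℝ) : (circlePt t).re = 1 / Real.cosh (π * t) := by
  simp only [circlePt, add_re, ofReal_re, re_ofReal_mul, I_re, mul_zero, add_zero]

lemma circlePt_im (t : ℝ) : (circlePt t).im = Real.sinh (π * t) / Real.cosh (π * t) := by
  simp only [circlePt, add_im, ofReal_im, im_ofReal_mul, I_im, mul_one, zero_add]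

lemma circlePt_sq (t : ℝ) : (circlePt t).re ^ 2 + (circlePt t).im ^ 2 = 1 := by
  rw [circlePt_re, circlePt_im]
  have h := Real.cosh_sq (π * t)
  have h0 := (Real.cosh_pos (π * t)).ne'
  field_simp
  linarith

lemma norm_circlePt (t : ℝ) : ‖circlePt t‖ = 1 := by
  rw [Complex.norm_eq_sqrt_sq_add_sq, circlePt_sq, Real.sqrt_one]

lemma stripMap_zero : stripMap 0 = 0 := by simp [stripMap]

lemma one_add_I_mul_div_one_sub_I_mul_eq {w : ℂ} (h : 1 - I * w ≠ 0) :
    (1 + I * w) / (1 - I * w) =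
      (((1 - ‖w‖ ^ 2) / normSq (1 - I * w) : ℝ) : ℂ) +
        ((2 * w.re / normSq (1 - I * w) : ℝ) : ℂ) * I := by
  have h1 : normSq (1 - I * w) ≠ 0 := by simpa using h
  rw [div_eq_iff h]
  have h2 : ((normSq (1 - I * w) : ℝ) : ℂ) ≠ 0 := by exact_mod_cast h1
  push_cast
  field_simp
  rw [← ofReal_pow, ← Complex.normSq_eq_norm_sq]
  apply Complex.ext <;> simp [normSq_apply] <;> ring

lemma one_sub_I_mul_ne_zero {w : ℂ} (h : ‖w‖ < 1 ∨ w.re ≠ 0) : 1 - I * w ≠ 0 := by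
  intro h0
  have h1 : w = -I := by
    have : I * w = 1 := (sub_eq_zero.mp h0).symm
    calc w = -I * (I * w) := by rw [← mul_assoc]; simp
      _ = -I := by rw [this]; simp
  subst h1
  simp at h

lemma stripMap_arg_mem_slitPlane {w : ℂ} (hw : ‖w‖ ≤ 1) (h : ‖w‖ < 1 ∨ w.re ≠ 0) :
    (1 + I * w) / (1 - I * w) ∈ slitPlane := by
  have h0 := one_sub_I_mul_ne_zero h
  have h1 : 0 < normSq (1 - I * w) := normSq_pos.mpr h0
  rw [one_add_I_mul_div_one_sub_I_mul_eq h0, mem_slitPlane_iff]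
  rcases h with h | h
  · left
    simp only [add_re, ofReal_re, re_ofReal_mul, I_re, mul_zero, add_zero]
    have : ‖w‖ ^ 2 < 1 := by nlinarith [norm_nonneg w]
    apply div_pos (by linarith) h1
  · right
    simp only [add_im, ofReal_im, im_ofReal_mul, I_im, mul_one, zero_add]
    positivity

/-- Analyticity holds up to the boundary circle, away from the points `±I` that go to infinity. -/
lemma analyticAt_stripMap {w : ℂ} (hw : ‖w‖ ≤ 1) (h : ‖w‖ < 1 ∨ w.re ≠ 0) :
    AnalyticAt ℂ stripMap w := by
  unfold stripMap
  have h0 := one_sub_I_mul_ne_zero h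
  have := stripMap_arg_mem_slitPlane hw h
  have hp : I * (π : ℂ) ≠ 0 := by simp
  have hq : AnalyticAt ℂ (fun w => (1 + I * w) / (1 - I * w)) w :=
    AnalyticAt.fun_div (by fun_prop) (by fun_prop) h0
  exact (hq.clog this).div analyticAt_const hp

lemma stripMap_eq (w : ℂ) : stripMap w =
    ((arg ((1 + I * w) / (1 - I * w)) / π : ℝ) : ℂ)
      - ((Real.log ‖(1 + I * w) / (1 - I * w)‖ / π : ℝ) : ℂ) * I := by
  have hp : (π : ℂ) ≠ 0 := by exact_mod_cast Real.pi_ne_zero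
  rw [stripMap, Complex.log]
  push_cast
  field_simp
  ring_nf
  simp

lemma stripMap_re (w : ℂ) : (stripMap w).re = arg ((1 + I * w) / (1 - I * w)) / π := by
  rw [stripMap_eq]
  simp only [sub_re, ofReal_re, re_ofReal_mul, I_re, mul_zero, sub_zero]

lemma stripMap_im (w : ℂ) : (stripMap w).im = -(Real.log ‖(1 + I * w) / (1 - I * w)‖ / π) := by
  rw [stripMap_eq]
  simp only [sub_im, ofReal_im, im_ofReal_mul, I_im, mul_one, zero_sub]

lemma abs_stripMap_re_le {w : ℂ} (hw : ‖w‖ ≤ 1) (h : ‖w‖ < 1 ∨ w.re ≠ 0) :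
    |(stripMap w).re| ≤ 1 / 2 := by
  have h0 := one_sub_I_mul_ne_zero h
  rw [stripMap_re, abs_div, abs_of_pos Real.pi_pos, div_le_iff₀ Real.pi_pos]
  have : |arg ((1 + I * w) / (1 - I * w))| ≤ π / 2 := by
    rw [abs_arg_le_pi_div_two_iff, one_add_I_mul_div_one_sub_I_mul_eq h0]
    simp only [add_re, ofReal_re, re_ofReal_mul, I_re, mul_zero, add_zero]
    apply div_nonneg _ (normSq_nonneg _)
    nlinarith [norm_nonneg w]
  linarith

lemma stripMap_circlePt (t : ℝ) : stripMap (circlePt t) = 1 / 2 + t * I := by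
  have hp : (π : ℂ) ≠ 0 := by exact_mod_cast Real.pi_ne_zero
  have h0 : 1 - I * circlePt t ≠ 0 :=
    one_sub_I_mul_ne_zero (Or.inr (by rw [circlePt_re]; have := Real.cosh_pos (π * t); positivity))
  have h1 : (1 + I * circlePt t) / (1 - I * circlePt t) = (Real.exp (-(π * t)) : ℝ) * I := by
    rw [div_eq_iff h0]
    have hc := (Real.cosh_pos (π * t)).ne'
    have h2 := Real.cosh_sq (π * t)
    have h3 : Real.exp (-(π * t)) = Real.cosh (π * t) - Real.sinh (π * t) :=
      (Real.cosh_sub_sinh _).symm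
    rw [h3]
    apply Complex.ext
    · simp [circlePt_re, circlePt_im, -Complex.ofReal_cosh, -Complex.ofReal_sinh,
        -Real.cosh_sub_sinh]
      field_simp
      ring
    · simp [circlePt_re, circlePt_im, -Complex.ofReal_cosh, -Complex.ofReal_sinh,
        -Real.cosh_sub_sinh]
      field_simp
      nlinarith
  rw [stripMap, h1, Complex.log_ofReal_mul (Real.exp_pos _) I_ne_zero, Real.log_exp, log_I]
  push_cast
  field_simp
  ring_nf
  simp

lemma stripMap_neg {w : ℂ} (hw : ‖w‖ ≤ 1) (h : ‖w‖ < 1 ∨ w.re ≠ 0) :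
    stripMap (-w) = -stripMap w := by
  have h1 := stripMap_arg_mem_slitPlane hw h
  have : (1 + I * -w) / (1 - I * -w) = ((1 + I * w) / (1 - I * w))⁻¹ := by
    rw [inv_div]; congr 1 <;> ring
  rw [stripMap, this, log_inv _ (mem_slitPlane_iff_arg.mp h1).1, stripMap, neg_div]

/-- Along the radius through `circlePt t` the map `stripMap` does not go much higher than its
boundary value: this is what makes the dilation `r → 1` dominated. -/
lemma abs_stripMap_im_le {r : ℝ} (hr0 : 0 ≤ r) (hr : r ≤ 1) (t : ℝ) :
    |(stripMap (r * circlePt t)).im| ≤ |t| + 1 := by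
  set c := Real.cosh (π * t) with hc
  set s := Real.sinh (π * t) with hs
  have hcp : 0 < c := Real.cosh_pos _
  have hcs : c ^ 2 = s ^ 2 + 1 := Real.cosh_sq _
  have hn : ‖(r : ℂ) * circlePt t‖ ≤ 1 := by
    rw [norm_mul, norm_circlePt, mul_one]; simpa [abs_of_nonneg hr0] using hr
  have hup1 : ‖1 + I * (r * circlePt t)‖ ≤ 2 := by
    refine (norm_add_le _ _).trans ?_
    rw [norm_mul, norm_I, norm_one]; linarith
  have hup2 : ‖1 - I * (r * circlePt t)‖ ≤ 2 := by
    refine (norm_sub_le _ _).trans ?_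
    rw [norm_mul, norm_I, norm_one]; linarith
  -- `1 + r ^ 2 ± 2 * r * tanh ≥ 1 - tanh ^ 2 = 1 / cosh ^ 2`, by completing the square
  have hlow1 : 1 / c ≤ ‖1 + I * (r * circlePt t)‖ := by
    rw [Complex.norm_eq_sqrt_sq_add_sq]
    apply Real.le_sqrt_of_sq_le
    simp [circlePt_re, circlePt_im, ← hc, ← hs]
    field_simp
    nlinarith [sq_nonneg (r * c - s)]
  have hlow2 : 1 / c ≤ ‖1 - I * (r * circlePt t)‖ := by
    rw [Complex.norm_eq_sqrt_sq_add_sq]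
    apply Real.le_sqrt_of_sq_le
    simp [circlePt_re, circlePt_im, ← hc, ← hs]
    field_simp
    nlinarith [sq_nonneg (r * c + s)]
  have hc1 : 0 < 1 / c := by positivity
  have hclog : Real.log (1 / c) ≥ -(π * |t|) := by
    rw [one_div, Real.log_inv, ge_iff_le, neg_le_neg_iff, Real.log_le_iff_le_exp hcp]
    have : c ≤ Real.exp |π * t| := by
      rw [hc, ← Real.cosh_abs, Real.cosh_eq]
      have : Real.exp (-|π * t|) ≤ Real.exp |π * t| :=
        Real.exp_le_exp.mpr (by linarith [abs_nonneg (π * t)])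
      linarith
    rwa [abs_mul, abs_of_pos Real.pi_pos] at this
  have hl2 : Real.log 2 ≤ π := by
    have := Real.log_two_lt_d9; have := Real.pi_gt_three; linarith
  rw [stripMap_im, abs_neg, abs_div, abs_of_pos Real.pi_pos, div_le_iff₀ Real.pi_pos, norm_div,
    Real.log_div (by linarith) (by linarith), abs_le]
  have a1 := Real.log_le_log (hc1.trans_le hlow1) hup1
  have a2 := Real.log_le_log (hc1.trans_le hlow2) hup2
  have a3 := Real.log_le_log hc1 hlow1
  have a4 := Real.log_le_log hc1 hlow2
  constructor <;> nlinarith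

/-- Every point of the open strip other than its centre is the image of a nonzero point of the
open disc. -/
lemma exists_stripMap_eq {z : ℂ} (hz : |z.re| < 1 / 2) (hz0 : z ≠ 0) :
    ∃ w, ‖w‖ < 1 ∧ w ≠ 0 ∧ stripMap w = z := by
  have hp : (π : ℂ) ≠ 0 := by exact_mod_cast Real.pi_ne_zero
  have hpi := Real.pi_pos
  rw [abs_lt] at hz
  set u := exp (I * π * z) with hu
  have hui : (I * π * z).im = π * z.re := by simp
  have hre : 0 < u.re := by
    rw [hu, exp_re, hui]
    apply mul_pos (Real.exp_pos _) (Real.cos_pos_of_mem_Ioo ⟨by nlinarith, by nlinarith⟩)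
  have hu1 : u + 1 ≠ 0 := by
    intro h
    have := congrArg re h
    simp at this
    linarith
  have hlog : log u = I * π * z := log_exp (by rw [hui]; nlinarith) (by rw [hui]; nlinarith)
  have hquot : (1 + I * ((u - 1) / (I * (u + 1)))) / (1 - I * ((u - 1) / (I * (u + 1)))) = u := by
    have : I * ((u - 1) / (I * (u + 1))) = (u - 1) / (u + 1) := by field_simp
    rw [this]
    have h2 : 1 - (u - 1) / (u + 1) = 2 / (u + 1) := by field_simp; ring
    have h3 : 1 + (u - 1) / (u + 1) = 2 * u / (u + 1) := by field_simp; ring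
    rw [h2, h3]
    field_simp
  have hmap : stripMap ((u - 1) / (I * (u + 1))) = z := by
    rw [stripMap, hquot, hlog]
    field_simp
  refine ⟨(u - 1) / (I * (u + 1)), ?_, ?_, hmap⟩
  · rw [norm_div, norm_mul, norm_I, one_mul, div_lt_one (norm_pos_iff.mpr hu1),
      Complex.norm_eq_sqrt_sq_add_sq, Complex.norm_eq_sqrt_sq_add_sq]
    apply Real.sqrt_lt_sqrt (by positivity)
    simp
    nlinarith
  · intro h
    rw [h, stripMap_zero] at hmap
    exact hz0 hmap.symm

/-! ### Circle averages as integrals against `1 / cosh (π t)` -/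

lemma hasDerivAt_arctan_sinh (t : ℝ) :
    HasDerivAt (fun t => Real.arctan (Real.sinh (π * t))) (π / Real.cosh (π * t)) t := by
  have h1 : HasDerivAt (fun t : ℝ => π * t) π t := by simpa using (hasDerivAt_id t).const_mul π
  have h2 := (Real.hasDerivAt_arctan (Real.sinh (π * t))).comp t
    ((Real.hasDerivAt_sinh (π * t)).comp t h1)
  refine h2.congr_deriv ?_
  have := (Real.cosh_pos (π * t)).ne'
  rw [add_comm 1, ← Real.cosh_sq]
  field_simp

lemma injective_arctan_sinh : Function.Injective (fun t => Real.arctan (Real.sinh (π * t))) := by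
  intro a b h
  have := Real.sinh_injective (Real.arctan_injective h)
  exact mul_left_cancel₀ Real.pi_ne_zero this

lemma range_arctan_sinh :
    (fun t => Real.arctan (Real.sinh (π * t))) '' univ = Ioo (-(π / 2)) (π / 2) := by
  rw [← Real.range_arctan, image_univ]
  apply Subset.antisymm
  · rintro _ ⟨t, rfl⟩; exact ⟨_, rfl⟩
  · rintro _ ⟨x, rfl⟩
    obtain ⟨y, rfl⟩ := Real.sinh_surjective x
    refine ⟨y / π, ?_⟩
    simp [mul_div_cancel₀, Real.pi_ne_zero]

/-- The angle of `circlePt t` is the Gudermannian of `π * t`. Its derivative `π / cosh (π * t)` is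
where the kernel comes from. -/
lemma exp_arctan_sinh (t : ℝ) : exp (Real.arctan (Real.sinh (π * t)) * I) = circlePt t := by
  have : √(1 + Real.sinh (π * t) ^ 2) = Real.cosh (π * t) := by
    rw [add_comm, ← Real.cosh_sq, Real.sqrt_sq (Real.cosh_pos _).le]
  rw [exp_mul_I, ← ofReal_cos, ← ofReal_sin, Real.cos_arctan, Real.sin_arctan, this, circlePt]

lemma integral_Ioo_eq_integral_cosh (H : ℝ → ℝ) :
    ∫ θ in Ioo (-(π / 2)) (π / 2), H θ =
      ∫ t, π / Real.cosh (π * t) * H (Real.arctan (Real.sinh (π * t))) := by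
  rw [← range_arctan_sinh, integral_image_eq_integral_abs_deriv_smul MeasurableSet.univ
    (fun x _ => (hasDerivAt_arctan_sinh x).hasDerivWithinAt) injective_arctan_sinh.injOn,
    setIntegral_univ]
  congr 1 with t
  rw [abs_of_pos (div_pos Real.pi_pos (Real.cosh_pos _)), smul_eq_mul]

lemma integrableOn_Ioo_iff_integrable_cosh (H : ℝ → ℝ) :
    IntegrableOn H (Ioo (-(π / 2)) (π / 2)) ↔
      Integrable fun t => π / Real.cosh (π * t) * H (Real.arctan (Real.sinh (π * t))) := by
  rw [← range_arctan_sinh, integrableOn_image_iff_integrableOn_abs_deriv_smul MeasurableSet.univ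
    (fun x _ => (hasDerivAt_arctan_sinh x).hasDerivWithinAt) injective_arctan_sinh.injOn,
    integrableOn_univ]
  congr! 2 with t
  rw [abs_of_pos (div_pos Real.pi_pos (Real.cosh_pos _)), smul_eq_mul]

lemma circleMap_arctan_sinh (r t : ℝ) :
    circleMap 0 r (Real.arctan (Real.sinh (π * t))) = r * circlePt t := by
  rw [circleMap_zero, exp_arctan_sinh]

/-- Both halves of the circle of radius `r` contribute an integral over the line. -/
lemma circleAverage_eq_integral_cosh {h : ℂ → ℝ} {r : ℝ} (hh : CircleIntegrable h 0 r) :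
    Integrable (fun t => h (r * circlePt t) / Real.cosh (π * t)) ∧
    Integrable (fun t => h (-(r * circlePt t)) / Real.cosh (π * t)) ∧
    2 * Real.circleAverage h 0 r =
      (∫ t, h (r * circlePt t) / Real.cosh (π * t)) +
        ∫ t, h (-(r * circlePt t)) / Real.cosh (π * t) := by
  have hpi := Real.pi_pos
  set G : ℝ → ℝ := fun θ => h (circleMap 0 r θ) with hG
  have hper : Function.Periodic G (2 * π) := fun x => by simp [hG, periodic_circleMap 0 r x]
  have hneg : ∀ θ, G (θ + π) = h (-circleMap 0 r θ) := by
    intro θ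
    simp only [hG, circleMap_zero]
    congr 1
    push_cast
    rw [add_mul, Complex.exp_add, Complex.exp_pi_mul_I]; ring
  have hint : ∀ a b, IntervalIntegrable G volume a b := by
    intro a b
    exact hper.intervalIntegrable₀ (by positivity) hh a b
  have e1 : IntervalIntegrable G volume (-(π / 2)) (π / 2) := hint _ _
  have e2 : IntervalIntegrable (fun θ => G (θ + π)) volume (-(π / 2)) (π / 2) := by
    have := (hint (-(π / 2) + π) (π / 2 + π)).comp_add_right π
    simpa using this
  have i1 := (intervalIntegrable_iff_integrableOn_Ioo_of_le (by linarith)).mp e1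
  have i2 := (intervalIntegrable_iff_integrableOn_Ioo_of_le (by linarith)).mp e2
  rw [integrableOn_Ioo_iff_integrable_cosh] at i1 i2
  have j1 := i1.const_mul π⁻¹
  have j2 := i2.const_mul π⁻¹
  have k1 : ∀ t, π⁻¹ * (π / Real.cosh (π * t) * G (Real.arctan (Real.sinh (π * t)))) =
      h (r * circlePt t) / Real.cosh (π * t) := by
    intro t
    simp only [hG, circleMap_arctan_sinh]
    field_simp
  have k2 : ∀ t, π⁻¹ * (π / Real.cosh (π * t) * G (Real.arctan (Real.sinh (π * t)) + π)) =
      h (-(r * circlePt t)) / Real.cosh (π * t) := by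
    intro t
    rw [hneg, circleMap_arctan_sinh]
    field_simp
  simp only [k1] at j1
  simp only [k2] at j2
  refine ⟨j1, j2, ?_⟩
  have hsplit : ∫ θ in (0 : ℝ)..2 * π, G θ =
      (∫ θ in (-(π / 2))..(π / 2), G θ) + ∫ θ in (-(π / 2))..(π / 2), G (θ + π) := by
    rw [intervalIntegral.integral_comp_add_right]
    have h1 := hper.intervalIntegral_add_eq 0 (-(π / 2))
    rw [zero_add] at h1
    rw [h1, show -(π / 2) + π = π / 2 by ring,
      intervalIntegral.integral_add_adjacent_intervals (hint _ _) (hint _ _)]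
    congr 1; ring
  rw [Real.circleAverage, hsplit, smul_eq_mul,
    intervalIntegral.integral_of_le (by linarith), intervalIntegral.integral_of_le (by linarith),
    integral_Ioc_eq_integral_Ioo, integral_Ioc_eq_integral_Ioo, integral_Ioo_eq_integral_cosh,
    integral_Ioo_eq_integral_cosh]
  simp only [← k1, ← k2, integral_const_mul]
  field_simp

/-! ### Jensen's inequality for the strip -/

/-- Functions of linear growth are integrable against `1 / cosh (a * t)`. -/
lemma integrable_linear_div_cosh {a : ℝ} (ha : 0 < a) (C : ℝ) :
    Integrable fun t : ℝ => C * (1 + |t|) / Real.cosh (a * t) := by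
  have hcont : Continuous fun t : ℝ => C * (1 + |t|) / Real.cosh (a * t) := by
    refine Continuous.div (by fun_prop) (Real.continuous_cosh.comp (by fun_prop)) ?_
    exact fun t => (Real.cosh_pos _).ne'
  refine hcont.locallyIntegrable.integrable_of_isBigO_atTop_of_norm_isNegInvariant
    (g := fun t => Real.exp (-(a / 2) * t)) (Eventually.of_forall fun t => by simp) ?_
    ⟨Ioi 0, Ioi_mem_atTop 0, exp_neg_integrableOn_Ioi 0 (by positivity)⟩
  have h1 : (fun t : ℝ => 1 + t) =O[atTop] fun t => Real.exp (a / 2 * t) := by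
    refine Asymptotics.IsBigO.add ?_ ?_
    · simpa using (isLittleO_pow_exp_pos_mul_atTop 0 (by positivity : 0 < a / 2)).isBigO
    · simpa using (isLittleO_pow_exp_pos_mul_atTop 1 (by positivity : 0 < a / 2)).isBigO
  obtain ⟨K, hK⟩ := h1.bound
  refine Asymptotics.IsBigO.of_bound (|C| * K * 2) ?_
  filter_upwards [hK, eventually_ge_atTop 0] with t ht ht0
  have hcosh : Real.exp (a * t) / 2 ≤ Real.cosh (a * t) := by
    rw [Real.cosh_eq]; linarith [Real.exp_pos (-(a * t))]
  have he : Real.exp (a * t) = Real.exp (a / 2 * t) * Real.exp (a / 2 * t) := by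
    rw [← Real.exp_add]; ring_nf
  have he2 : Real.exp (-(a / 2) * t) * Real.exp (a / 2 * t) = 1 := by
    rw [← Real.exp_add]; simp
  rw [Real.norm_eq_abs, Real.norm_eq_abs, Real.abs_exp, abs_of_nonneg (by linarith)] at ht
  rw [Real.norm_eq_abs, Real.norm_eq_abs, Real.abs_exp, abs_div, abs_mul,
    abs_of_pos (Real.cosh_pos _), abs_of_nonneg ht0, abs_of_nonneg (by linarith : 0 ≤ 1 + t),
    div_le_iff₀ (Real.cosh_pos _)]
  have hKpos : 0 ≤ K := by
    by_contra! h
    nlinarith [Real.exp_pos (a / 2 * t)]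
  calc |C| * (1 + t) ≤ |C| * (K * Real.exp (a / 2 * t)) := by gcongr
    _ = |C| * K * 2 * Real.exp (-(a / 2) * t) * (Real.exp (a * t) / 2) := by
      rw [he]; linear_combination (-(|C| * K * Real.exp (a / 2 * t))) * he2
    _ ≤ _ := by gcongr

/-- An analytic function that is not identically zero has only a null set of zeros on a vertical
line, so that convergence of `log ‖f‖` need not be discussed at them. -/
lemma ae_ne_zero_of_analytic_line {f : ℂ → ℂ} {U : Set ℂ} (hU : IsPreconnected U)
    (hf : AnalyticOnNhd ℂ f U) {z₀ : ℂ} (hz₀ : z₀ ∈ U) (h0 : f z₀ ≠ 0) {σ : ℝ}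
    (hσ : ∀ t : ℝ, (σ : ℂ) + t * I ∈ U) : ∀ᵐ t : ℝ, f (σ + t * I) ≠ 0 := by
  have hline : AnalyticOnNhd ℝ (fun t : ℝ => f (σ + t * I)) univ := by
    intro t _
    have h1 : AnalyticAt ℝ f (σ + t * I) := (hf _ (hσ t)).restrictScalars
    have h2 : AnalyticAt ℝ (fun t : ℝ => (σ : ℂ) + t * I) t := by
      have : AnalyticAt ℝ (fun t : ℝ => (t : ℂ)) t := ofRealCLM.analyticAt t
      fun_prop
    exact h1.comp_of_eq h2 rfl
  obtain ⟨t₀, ht₀⟩ : ∃ t : ℝ, f (σ + t * I) ≠ 0 := by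
    by_contra! hall
    have hfr : ∃ᶠ z in 𝓝[≠] (σ : ℂ), f z = 0 := by
      have htend : Tendsto (fun t : ℝ => (σ : ℂ) + t * I) (𝓝[≠] 0) (𝓝[≠] (σ : ℂ)) := by
        apply tendsto_nhdsWithin_of_tendsto_nhds_of_eventually_within
        · have : Continuous (fun t : ℝ => (σ : ℂ) + t * I) := by fun_prop
          have := this.tendsto 0
          simp only [ofReal_zero, zero_mul, add_zero] at this
          exact this.mono_left nhdsWithin_le_nhds
        · filter_upwards [self_mem_nhdsWithin] with t ht
          simpa using ht
      exact htend.frequently (Eventually.of_forall hall).frequently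
    exact h0 (hf.eqOn_zero_of_preconnected_of_frequently_eq_zero hU (by simpa using hσ 0) hfr hz₀)
  -- the zeros of a real-analytic function that is not identically zero are isolated, hence null
  have h3 := hline.preimage_zero_mem_codiscrete (x := t₀) ht₀
  have h4 := ae_restrict_le_codiscreteWithin (μ := (volume : Measure ℝ)) MeasurableSet.univ h3
  rw [Measure.restrict_univ] at h4
  filter_upwards [h4] with t ht
  simpa using ht

lemma ae_ne_zero_of_analytic_strip {f : ℂ → ℂ} (hf : ∀ z : ℂ, |z.re| ≤ 1 / 2 → AnalyticAt ℂ f z)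
    (h0 : f 0 ≠ 0) {σ : ℝ} (hσ : |σ| ≤ 1 / 2) : ∀ᵐ t : ℝ, f (σ + t * I) ≠ 0 := by
  set U : Set ℂ := reLm ⁻¹' Icc (-(1 / 2) : ℝ) (1 / 2) with hUdef
  have hmemU : ∀ z : ℂ, z ∈ U ↔ |z.re| ≤ 1 / 2 := by
    intro z; rw [hUdef, mem_preimage, mem_Icc, abs_le]; rfl
  exact ae_ne_zero_of_analytic_line
    ((convex_Icc (-(1 / 2) : ℝ) (1 / 2)).linear_preimage reLm).isPreconnected
    (fun z hz => hf z ((hmemU z).mp hz)) ((hmemU 0).mpr (by simp)) h0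
    (fun t => (hmemU _).mpr (by simpa using hσ))

lemma log_norm_le_of_norm_le_exp {z : ℂ} {B : ℝ} (hB : 0 ≤ B) (h : ‖z‖ ≤ Real.exp B) :
    Real.log ‖z‖ ≤ B := by
  rcases eq_or_ne z 0 with rfl | hz
  · simpa using hB
  · exact (Real.log_le_iff_le_exp (norm_pos_iff.mpr hz)).mpr h

/-- One zero `w` raises the circle average of `log ‖g‖` by at least its term in Jensen's formula.
For `‖w‖ = r` the term vanishes. -/
lemma add_log_le_circleAverage_log_norm {g : ℂ → ℂ} {r : ℝ} (hr : 0 < r)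
    (hg : AnalyticOnNhd ℂ g (closedBall 0 r)) (h0 : g 0 ≠ 0) {w : ℂ} (hw : ‖w‖ ≤ r)
    (hgw : g w = 0) :
    Real.log ‖g 0‖ + Real.log (r / ‖w‖) ≤ Real.circleAverage (fun w => Real.log ‖g w‖) 0 r := by
  have hg' : AnalyticOnNhd ℂ g (closedBall 0 |r|) := by rwa [abs_of_pos hr]
  have hJ := hg'.circleAverage_log_norm hr.ne' h0
  rw [hJ, add_comm]
  gcongr
  have hfin := (MeromorphicOn.divisor g (closedBall 0 |r|)).finiteSupport
    (isCompact_closedBall 0 |r|)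
  have hterm : ∀ u, 0 ≤ (MeromorphicOn.divisor g (closedBall 0 |r|) u : ℝ) *
      Real.log (r * ‖0 - u‖⁻¹) := by
    intro u
    by_cases hu : u ∈ closedBall (0 : ℂ) |r|
    · refine mul_nonneg (mod_cast MeromorphicOn.AnalyticOnNhd.divisor_nonneg hg' u) ?_
      rcases eq_or_ne u 0 with rfl | hu0
      · simp
      · apply Real.log_nonneg
        rw [mem_closedBall_zero_iff, abs_of_pos hr] at hu
        rw [zero_sub, norm_neg, ← div_eq_mul_inv, le_div_iff₀ (norm_pos_iff.mpr hu0)]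
        linarith
    · simp [hu]
  have hw' : w ∈ closedBall (0 : ℂ) |r| := by
    rwa [mem_closedBall_zero_iff, abs_of_pos hr]
  have hone : (1 : ℝ) ≤ MeromorphicOn.divisor g (closedBall 0 |r|) w := by
    have hpos : MeromorphicOn.divisor g (closedBall 0 |r|) w ≠ 0 := by
      rw [MeromorphicOn.AnalyticOnNhd.divisor_apply hg' hw']
      have h1 : analyticOrderAt g w ≠ 0 := (hg' w hw').analyticOrderAt_ne_zero.mpr hgw
      have h2 : analyticOrderAt g w ≠ ⊤ := by
        intro htop
        rw [analyticOrderAt_eq_top] at htop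
        have := hg'.eqOn_zero_of_preconnected_of_eventuallyEq_zero
          (convex_closedBall _ _).isPreconnected hw' htop
        exact h0 (this (by simp))
      lift analyticOrderAt g w to ℕ using h2 with n hn
      simpa using h1
    have := MeromorphicOn.AnalyticOnNhd.divisor_nonneg hg' w
    have h3 : (1 : ℤ) ≤ MeromorphicOn.divisor g (closedBall 0 |r|) w := by
      have h4 : (0 : ℤ) ≤ MeromorphicOn.divisor g (closedBall 0 |r|) w := this
      omega
    exact_mod_cast h3
  have hsingle := single_le_finsum (M := ℝ) w
    (f := fun u => (MeromorphicOn.divisor g (closedBall 0 |r|) u : ℝ) * Real.log (r * ‖0 - u‖⁻¹))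
    (hfin.subset (fun u hu => by
      simp only [Function.mem_support, ne_eq, mul_eq_zero, not_or, Int.cast_eq_zero] at hu ⊢
      exact hu.1)) hterm
  refine le_trans ?_ hsingle
  have hlog : 0 ≤ Real.log (r * ‖0 - w‖⁻¹) := by
    apply Real.log_nonneg
    have hw0 : w ≠ 0 := by rintro rfl; exact h0 hgw
    rw [zero_sub, norm_neg, ← div_eq_mul_inv, le_div_iff₀ (norm_pos_iff.mpr hw0)]
    linarith
  have : Real.log (r / ‖w‖) = Real.log (r * ‖0 - w‖⁻¹) := by simp [div_eq_mul_inv]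
  rw [this]
  exact le_mul_of_one_le_left hlog hone

lemma le_circleAverage_log_norm {g : ℂ → ℂ} {r : ℝ} (hr : 0 < r)
    (hg : AnalyticOnNhd ℂ g (closedBall 0 r)) (h0 : g 0 ≠ 0) :
    Real.log ‖g 0‖ ≤ Real.circleAverage (fun w => Real.log ‖g w‖) 0 r := by
  by_cases h : ∃ w ∈ closedBall (0 : ℂ) r, g w = 0
  · obtain ⟨w, hw, hgw⟩ := h
    rw [mem_closedBall_zero_iff] at hw
    have hw0 : w ≠ 0 := by rintro rfl; exact h0 hgw
    have h1 := add_log_le_circleAverage_log_norm hr hg h0 hw hgw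
    have h2 : 0 ≤ Real.log (r / ‖w‖) := by
      apply Real.log_nonneg
      rw [le_div_iff₀ (norm_pos_iff.mpr hw0)]; linarith
    linarith
  · push Not at h
    have hg' : AnalyticOnNhd ℂ g (closedBall 0 |r|) := by rwa [abs_of_pos hr]
    exact (hg'.circleAverage_log_norm_of_ne_zero (by rwa [abs_of_pos hr])).ge

/-- Fatou's lemma along the circles `|w| = r`, `r → 1`, transported to the strip: a lower bound for
the circle averages of `log ‖f ∘ stripMap‖` passes to the boundary of the strip. The growth
hypothesis on `f` provides the integrable majorant. -/
lemma strip_fatou {f : ℂ → ℂ} {C m : ℝ} (hC : 0 ≤ C)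
    (hf : ∀ z : ℂ, |z.re| ≤ 1 / 2 → AnalyticAt ℂ f z)
    (hgrowth : ∀ z : ℂ, |z.re| ≤ 1 / 2 → ‖f z‖ ≤ Real.exp (C * (1 + |z.im|)))
    (h0 : f 0 ≠ 0)
    (hm : ∀ᶠ r in 𝓝[<] (1 : ℝ), m ≤ Real.circleAverage (fun w => Real.log ‖f (stripMap w)‖) 0 r) :
    Integrable (fun t : ℝ => Real.log ‖f (1 / 2 + t * I)‖ / Real.cosh (π * t)) ∧
    Integrable (fun t : ℝ => Real.log ‖f (-(1 / 2 + t * I))‖ / Real.cosh (π * t)) ∧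
    2 * m ≤ (∫ t : ℝ, Real.log ‖f (1 / 2 + t * I)‖ / Real.cosh (π * t)) +
      ∫ t : ℝ, Real.log ‖f (-(1 / 2 + t * I))‖ / Real.cosh (π * t) := by
  set D : ℝ → ℝ := fun t => 2 * C * (1 + |t|) / Real.cosh (π * t) with hD
  have hDint : Integrable D := integrable_linear_div_cosh Real.pi_pos _
  have hcosh : ∀ t : ℝ, 0 < Real.cosh (π * t) := fun t => Real.cosh_pos _
  have hpre : ∀ t : ℝ, (circlePt t).re ≠ 0 := fun t => by
    rw [circlePt_re]; exact (div_pos one_pos (hcosh t)).ne'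
  -- the upper bound for the logarithm along the dilated circles and on the boundary
  have hmaj : ∀ (z : ℂ) (t : ℝ), |z.re| ≤ 1 / 2 → |z.im| ≤ |t| + 1 →
      0 ≤ D t - Real.log ‖f z‖ / Real.cosh (π * t) := by
    intro z t hz hz'
    rw [hD]
    simp only
    rw [← sub_div]
    apply div_nonneg _ (hcosh t).le
    have := log_norm_le_of_norm_le_exp (by positivity) (hgrowth z hz)
    nlinarith [abs_nonneg t]
  have hpt : ∀ (r t : ℝ), 0 ≤ r → r ≤ 1 → (r < 1 ∨ r ≠ 0) → ∀ w : ℂ, w = r * circlePt t ∨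
      w = -(r * circlePt t) → ‖w‖ ≤ 1 ∧ (‖w‖ < 1 ∨ w.re ≠ 0) := by
    intro r t h0r h1r hr w hw
    have hn : ‖w‖ = r := by
      rcases hw with rfl | rfl <;> simp [norm_circlePt, abs_of_nonneg h0r]
    refine ⟨hn ▸ h1r, ?_⟩
    rcases hr with hr | hr
    · left; rw [hn]; exact hr
    · right
      rcases hw with rfl | rfl <;> simp [hr, hpre t]
  have him : ∀ (r t : ℝ), 0 ≤ r → r < 1 → |(stripMap (-(r * circlePt t))).im| ≤ |t| + 1 := by
    intro r t h0r h1r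
    have := (hpt r t h0r h1r.le (Or.inl h1r) _ (Or.inl rfl))
    rw [stripMap_neg this.1 this.2, neg_im, abs_neg]
    exact abs_stripMap_im_le h0r h1r.le t
  set r : ℕ → ℝ := fun n => 1 - 1 / (n + 2) with hr
  have hr0 : ∀ n, 0 ≤ r n := fun n => by
    simp only [hr, sub_nonneg]
    rw [div_le_one (by positivity)]; linarith [(Nat.cast_nonneg n : (0 : ℝ) ≤ n)]
  have hr0' : ∀ n, 0 < r n := fun n => by
    simp only [hr, sub_pos]
    rw [div_lt_one (by positivity)]; linarith [(Nat.cast_nonneg n : (0 : ℝ) ≤ n)]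
  have hr1 : ∀ n, r n < 1 := fun n => by
    simp only [hr]; have : (0 : ℝ) < 1 / (n + 2) := by positivity
    linarith
  have hrlim : Tendsto r atTop (𝓝 1) := by
    have h1 : Tendsto (fun n : ℕ => 1 / ((n : ℝ) + 2)) atTop (𝓝 0) := by
      have := tendsto_const_nhds (x := (1 : ℝ)) |>.div_atTop
        (tendsto_natCast_atTop_atTop.atTop_add (tendsto_const_nhds (x := (2 : ℝ))))
      exact this
    have h2 := (tendsto_const_nhds (x := (1 : ℝ))).sub h1
    rwa [sub_zero] at h2
  have hrlim' : Tendsto r atTop (𝓝[<] 1) :=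
    tendsto_nhdsWithin_of_tendsto_nhds_of_eventually_within _ hrlim (Eventually.of_forall hr1)
  have hcirc : ∀ n, CircleIntegrable (fun w => Real.log ‖f (stripMap w)‖) 0 (r n) := by
    intro n
    apply MeromorphicOn.circleIntegrable_log_norm (f := fun w => f (stripMap w))
    intro w hw
    rw [mem_sphere_zero_iff_norm, abs_of_pos (hr0' n)] at hw
    have hw1 : ‖w‖ < 1 := hw ▸ hr1 n
    exact ((hf _ (abs_stripMap_re_le hw1.le (Or.inl hw1))).comp
      (analyticAt_stripMap hw1.le (Or.inl hw1))).meromorphicAt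
  -- `ψ n` is the nonnegative defect to which Fatou's lemma applies, `a + b` its limit
  set ψ : ℕ → ℝ → ℝ := fun n t =>
    (D t - Real.log ‖f (stripMap (r n * circlePt t))‖ / Real.cosh (π * t)) +
    (D t - Real.log ‖f (stripMap (-(r n * circlePt t)))‖ / Real.cosh (π * t)) with hψ
  set a : ℝ → ℝ := fun t => D t - Real.log ‖f (1 / 2 + t * I)‖ / Real.cosh (π * t) with ha
  set b : ℝ → ℝ := fun t => D t - Real.log ‖f (-(1 / 2 + t * I))‖ / Real.cosh (π * t) with hb
  have ha0 : ∀ t, 0 ≤ a t := fun t => hmaj _ t (by norm_num) (by simp)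
  have hb0 : ∀ t, 0 ≤ b t := fun t => hmaj _ t (by norm_num) (by simp)
  have hψ0 : ∀ n t, 0 ≤ ψ n t := by
    intro n t
    have h1 := hpt (r n) t (hr0 n) (hr1 n).le (Or.inl (hr1 n))
    exact add_nonneg
      (hmaj _ t (abs_stripMap_re_le (h1 _ (Or.inl rfl)).1 (h1 _ (Or.inl rfl)).2)
        (abs_stripMap_im_le (hr0 n) (hr1 n).le t))
      (hmaj _ t (abs_stripMap_re_le (h1 _ (Or.inr rfl)).1 (h1 _ (Or.inr rfl)).2)
        (him _ t (hr0 n) (hr1 n)))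
  have hψint : ∀ n, Integrable (ψ n) := fun n =>
    (hDint.sub (circleAverage_eq_integral_cosh (hcirc n)).1).add
      (hDint.sub (circleAverage_eq_integral_cosh (hcirc n)).2.1)
  have hψval : ∀ n, ∫ t, ψ n t = 2 * (∫ t, D t) -
      2 * Real.circleAverage (fun w => Real.log ‖f (stripMap w)‖) 0 (r n) := by
    intro n
    obtain ⟨h1, h2, h3⟩ := circleAverage_eq_integral_cosh (hcirc n)
    have e := integral_add (hDint.sub h1) (hDint.sub h2)
    simp only [Pi.sub_apply] at e
    rw [h3, hψ]
    simp only
    rw [e, integral_sub hDint h1, integral_sub hDint h2]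
    ring
  have hlim : ∀ᵐ t : ℝ, Tendsto (fun n => ψ n t) atTop (𝓝 (a t + b t)) := by
    have z1 := ae_ne_zero_of_analytic_strip hf h0 (σ := 1 / 2) (by norm_num [abs_of_pos])
    have z2 := ae_ne_zero_of_analytic_strip (f := fun z => f (-z))
      (fun z hz => (hf (-z) (by simpa using hz)).comp_of_eq (by fun_prop) rfl) (by simpa using h0)
      (σ := 1 / 2) (by norm_num [abs_of_pos])
    filter_upwards [z1, z2] with t ht1 ht2
    push_cast at ht1 ht2
    have hw := hpt 1 t zero_le_one le_rfl (Or.inr one_ne_zero)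
    simp only [ofReal_one, one_mul] at hw
    have hrC : Tendsto (fun n => (r n : ℂ) * circlePt t) atTop (𝓝 (circlePt t)) := by
      have := (continuous_ofReal.tendsto 1).comp hrlim
      simpa using this.mul_const (circlePt t)
    have c1 : Tendsto (fun n => stripMap (r n * circlePt t)) atTop (𝓝 (1 / 2 + t * I)) := by
      rw [← stripMap_circlePt]
      exact (analyticAt_stripMap (hw _ (Or.inl rfl)).1
        (hw _ (Or.inl rfl)).2).continuousAt.tendsto.comp hrC
    have c2 : Tendsto (fun n => stripMap (-(r n * circlePt t))) atTop (𝓝 (-(1 / 2 + t * I))) := by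
      rw [← stripMap_circlePt, ← stripMap_neg (hw _ (Or.inl rfl)).1 (hw _ (Or.inl rfl)).2]
      exact (analyticAt_stripMap (hw _ (Or.inr rfl)).1
        (hw _ (Or.inr rfl)).2).continuousAt.tendsto.comp hrC.neg
    have d : ∀ {u : ℕ → ℂ} {z : ℂ}, |z.re| ≤ 1 / 2 → f z ≠ 0 → Tendsto u atTop (𝓝 z) →
        Tendsto (fun n => D t - Real.log ‖f (u n)‖ / Real.cosh (π * t)) atTop
          (𝓝 (D t - Real.log ‖f z‖ / Real.cosh (π * t))) := by
      intro u z hz hfz hu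
      have h1 := ((hf z hz).continuousAt.tendsto.comp hu).norm
      exact ((h1.log (norm_ne_zero_iff.mpr hfz)).div_const _).const_sub _
    exact (d (by norm_num) ht1 c1).add (d (by norm_num) ht2 c2)
  set B : ℝ := 2 * (∫ t, D t) - 2 * m with hB
  have hfatou : ∫⁻ t, ENNReal.ofReal (a t + b t) ≤ ENNReal.ofReal B := by
    calc ∫⁻ t, ENNReal.ofReal (a t + b t)
        = ∫⁻ t, liminf (fun n => ENNReal.ofReal (ψ n t)) atTop := by
          apply lintegral_congr_ae
          filter_upwards [hlim] with t ht
          exact (ENNReal.tendsto_ofReal ht).liminf_eq.symm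
      _ ≤ liminf (fun n => ∫⁻ t, ENNReal.ofReal (ψ n t)) atTop :=
          lintegral_liminf_le' fun n => (hψint n).aestronglyMeasurable.aemeasurable.ennreal_ofReal
      _ ≤ ENNReal.ofReal B := by
          apply liminf_le_of_frequently_le'
          apply Eventually.frequently
          filter_upwards [hrlim'.eventually hm] with n hn
          rw [← ofReal_integral_eq_lintegral_ofReal (hψint n) (Eventually.of_forall (hψ0 n)),
            hψval n]
          exact ENNReal.ofReal_le_ofReal (by linarith)
  have hline : ∀ s : ℂ, |s.re| ≤ 1 / 2 → ∀ e : ℂ, e.re = 0 →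
      Continuous fun t : ℝ => f (s + t * e) := by
    intro s hs e he
    rw [continuous_iff_continuousAt]
    intro t
    have h1 : ContinuousAt f (s + t * e) := (hf _ (by simpa [he] using hs)).continuousAt
    exact ContinuousAt.comp_of_eq h1 (by fun_prop) rfl
  have hma : Measurable fun t : ℝ => Real.log ‖f (1 / 2 + t * I)‖ / Real.cosh (π * t) :=
    (Real.measurable_log.comp (hline (1 / 2) (by norm_num) I I_re).norm.measurable).div
      (Real.continuous_cosh.comp (by fun_prop)).measurable
  have hmb : Measurable fun t : ℝ => Real.log ‖f (-(1 / 2 + t * I))‖ / Real.cosh (π * t) := by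
    have := (hline (-(1 / 2)) (by norm_num) (-I) (by simp)).norm.measurable
    have h2 : ∀ t : ℝ, -(1 / 2) + (t : ℂ) * -I = -(1 / 2 + t * I) := fun t => by ring
    simp only [h2] at this
    exact (Real.measurable_log.comp this).div (Real.continuous_cosh.comp (by fun_prop)).measurable
  have hint : Integrable fun t => a t + b t := by
    refine ⟨?_, ?_⟩
    · exact (hDint.aestronglyMeasurable.sub hma.aestronglyMeasurable).add
        (hDint.aestronglyMeasurable.sub hmb.aestronglyMeasurable)
    · rw [hasFiniteIntegral_iff_ofReal (Eventually.of_forall fun t => add_nonneg (ha0 t) (hb0 t))]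
      exact hfatou.trans_lt ENNReal.ofReal_lt_top
  have hia : Integrable a := hint.mono'
    (hDint.aestronglyMeasurable.sub hma.aestronglyMeasurable)
    (Eventually.of_forall fun t => by
      rw [Real.norm_eq_abs, abs_of_nonneg (ha0 t)]; linarith [hb0 t])
  have hib : Integrable b := hint.mono'
    (hDint.aestronglyMeasurable.sub hmb.aestronglyMeasurable)
    (Eventually.of_forall fun t => by
      rw [Real.norm_eq_abs, abs_of_nonneg (hb0 t)]; linarith [ha0 t])
  have i1 : Integrable fun t : ℝ => Real.log ‖f (1 / 2 + t * I)‖ / Real.cosh (π * t) := by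
    have := hDint.sub hia
    refine this.congr (Eventually.of_forall fun t => ?_)
    simp [ha]
  have i2 : Integrable fun t : ℝ => Real.log ‖f (-(1 / 2 + t * I))‖ / Real.cosh (π * t) := by
    have := hDint.sub hib
    refine this.congr (Eventually.of_forall fun t => ?_)
    simp [hb]
  refine ⟨i1, i2, ?_⟩
  have hle : ∫ t, (a t + b t) ≤ B := by
    have hBpos : 0 ≤ B := by
      obtain ⟨n, hn⟩ := (hrlim'.eventually hm).exists
      have := integral_nonneg (μ := volume) (show 0 ≤ ψ n from hψ0 n)
      rw [hψval n] at this
      linarith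
    rw [integral_eq_lintegral_of_nonneg_ae
      (Eventually.of_forall fun t => add_nonneg (ha0 t) (hb0 t))
      hint.aestronglyMeasurable]
    exact ENNReal.toReal_le_of_le_ofReal hBpos hfatou
  rw [integral_add hia hib, ha, hb, integral_sub hDint i1, integral_sub hDint i2] at hle
  linarith

section StripJensen

variable {f : ℂ → ℂ} {C : ℝ}

lemma analyticOnNhd_comp_stripMap (hf : ∀ z : ℂ, |z.re| ≤ 1 / 2 → AnalyticAt ℂ f z) {r : ℝ}
    (hr : r < 1) : AnalyticOnNhd ℂ (fun w => f (stripMap w)) (closedBall 0 r) := by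
  intro w hw
  rw [mem_closedBall_zero_iff] at hw
  have hw1 : ‖w‖ < 1 := hw.trans_lt hr
  exact (hf _ (abs_stripMap_re_le hw1.le (Or.inl hw1))).comp
    (analyticAt_stripMap hw1.le (Or.inl hw1))

/-- Jensen's inequality for the strip: the logarithm of `‖f‖` at the centre is at most its mean
with respect to harmonic measure, which has density `1 / (2 * cosh (π * t))` on either side. -/
theorem strip_jensen (hC : 0 ≤ C) (hf : ∀ z : ℂ, |z.re| ≤ 1 / 2 → AnalyticAt ℂ f z)
    (hgrowth : ∀ z : ℂ, |z.re| ≤ 1 / 2 → ‖f z‖ ≤ Real.exp (C * (1 + |z.im|))) (h0 : f 0 ≠ 0) :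
    Integrable (fun t : ℝ => Real.log ‖f (1 / 2 + t * I)‖ / Real.cosh (π * t)) ∧
    Integrable (fun t : ℝ => Real.log ‖f (-(1 / 2 + t * I))‖ / Real.cosh (π * t)) ∧
    2 * Real.log ‖f 0‖ ≤ (∫ t : ℝ, Real.log ‖f (1 / 2 + t * I)‖ / Real.cosh (π * t)) +
      ∫ t : ℝ, Real.log ‖f (-(1 / 2 + t * I))‖ / Real.cosh (π * t) := by
  refine strip_fatou hC hf hgrowth h0 ?_
  filter_upwards [Ioo_mem_nhdsLT (zero_lt_one : (0 : ℝ) < 1)] with r hr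
  have := le_circleAverage_log_norm hr.1 (analyticOnNhd_comp_stripMap hf hr.2)
    (by simpa [stripMap_zero] using h0)
  simpa [stripMap_zero] using this

/-- A zero inside the strip makes Jensen's inequality strict. -/
theorem strip_jensen_strict (hC : 0 ≤ C) (hf : ∀ z : ℂ, |z.re| ≤ 1 / 2 → AnalyticAt ℂ f z)
    (hgrowth : ∀ z : ℂ, |z.re| ≤ 1 / 2 → ‖f z‖ ≤ Real.exp (C * (1 + |z.im|))) (h0 : f 0 ≠ 0)
    {z : ℂ} (hz : |z.re| < 1 / 2) (hfz : f z = 0) :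
    2 * Real.log ‖f 0‖ < (∫ t : ℝ, Real.log ‖f (1 / 2 + t * I)‖ / Real.cosh (π * t)) +
      ∫ t : ℝ, Real.log ‖f (-(1 / 2 + t * I))‖ / Real.cosh (π * t) := by
  have hz0 : z ≠ 0 := by rintro rfl; exact h0 hfz
  obtain ⟨w, hw1, hw0, rfl⟩ := exists_stripMap_eq hz hz0
  have hwpos : 0 < ‖w‖ := norm_pos_iff.mpr hw0
  -- the circles of radius at least `q = (1 + ‖w‖) / 2` all gain at least `log (q / ‖w‖)`
  set q := (1 + ‖w‖) / 2 with hq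
  have hgain : 0 < Real.log (q / ‖w‖) := by
    apply Real.log_pos
    rw [lt_div_iff₀ hwpos]; linarith
  have h := (strip_fatou (m := Real.log ‖f 0‖ + Real.log (q / ‖w‖)) hC hf hgrowth h0 ?_).2.2
  · linarith
  filter_upwards [Ioo_mem_nhdsLT (show q < 1 by linarith)] with r hr
  have hr0 : 0 < r := by linarith [hr.1]
  have := add_log_le_circleAverage_log_norm hr0 (analyticOnNhd_comp_stripMap hf hr.2)
    (by simpa [stripMap_zero] using h0) (by linarith [hr.1] : ‖w‖ ≤ r) hfz
  simp only [stripMap_zero] at this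
  refine le_trans ?_ this
  gcongr
  exact hr.1.le

/-- The mean value property of `log ‖f‖` in the strip, for `f` without zeros there. -/
theorem strip_mean_value (hC : 0 ≤ C) (hf : ∀ z : ℂ, |z.re| ≤ 1 / 2 → AnalyticAt ℂ f z)
    (hgrowth : ∀ z : ℂ, |z.re| ≤ 1 / 2 → ‖f z‖ ≤ Real.exp (C * (1 + |z.im|)))
    (hne : ∀ z : ℂ, |z.re| ≤ 1 / 2 → f z ≠ 0)
    (hgrowth' : ∀ z : ℂ, |z.re| ≤ 1 / 2 → ‖(f z)⁻¹‖ ≤ Real.exp (C * (1 + |z.im|))) :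
    (∫ t : ℝ, Real.log ‖f (1 / 2 + t * I)‖ / Real.cosh (π * t)) +
      (∫ t : ℝ, Real.log ‖f (-(1 / 2 + t * I))‖ / Real.cosh (π * t)) = 2 * Real.log ‖f 0‖ := by
  have h0 : f 0 ≠ 0 := hne 0 (by simp)
  have h1 := (strip_jensen hC hf hgrowth h0).2.2
  have h2 := (strip_jensen (f := fun z => (f z)⁻¹) hC (fun z hz => (hf z hz).inv (hne z hz))
    hgrowth' (inv_ne_zero h0)).2.2
  simp only [norm_inv, Real.log_inv, neg_div, integral_neg] at h2
  linarith

end StripJensen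

/-! ### Growth of the zeta function -/

/-- The fractional part on `(1, ∞)`, extended by zero. Its Mellin transform at `-s` continues
`1 / (s - 1) - ζ(s) / s` to the half plane `Re s > 0`. -/
noncomputable def fractTail : ℝ → ℂ := (Ioi (1 : ℝ)).indicator fun x => ((Int.fract x : ℝ) : ℂ)

lemma norm_fractTail_le (x : ℝ) : ‖fractTail x‖ ≤ (Ioi (1 : ℝ)).indicator (fun _ => (1 : ℝ)) x := by
  unfold fractTail
  by_cases hx : x ∈ Ioi (1 : ℝ)
  · rw [indicator_of_mem hx, indicator_of_mem hx, norm_real, Real.norm_eq_abs, Int.abs_fract]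
    exact (Int.fract_lt_one x).le
  · simp [indicator_of_notMem hx]

lemma measurable_fractTail : Measurable fractTail :=
  Measurable.indicator (measurable_ofReal.comp measurable_fract) measurableSet_Ioi

lemma differentiableAt_mellin_fractTail {s : ℂ} (hs : s.re < 0) :
    DifferentiableAt ℂ (mellin fractTail) s := by
  refine mellin_differentiableAt_of_isBigO_rpow (a := 0) (b := s.re - 1) ?_ ?_ hs ?_ (by linarith)
  · have h1 : LocallyIntegrable fractTail := by
      have : LocallyIntegrable (fun _ : ℝ => (1 : ℝ)) := locallyIntegrable_const 1
      refine this.mono measurable_fractTail.aestronglyMeasurable (Eventually.of_forall fun x => ?_)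
      refine (norm_fractTail_le x).trans ?_
      simp only [indicator]
      split_ifs <;> simp
    exact h1.locallyIntegrableOn _
  · refine Asymptotics.IsBigO.of_bound 1 (Eventually.of_forall fun x => ?_)
    refine (norm_fractTail_le x).trans ?_
    simp only [indicator]
    split_ifs <;> simp
  · refine Asymptotics.IsBigO.of_bound 1 ?_
    filter_upwards [Ioo_mem_nhdsGT (zero_lt_one : (0 : ℝ) < 1)] with x hx
    have : x ∉ Ioi (1 : ℝ) := not_lt.mpr hx.2.le
    simp only [fractTail, indicator_of_notMem this, norm_zero]
    positivity

lemma mellin_fractTail_eq (s : ℂ) :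
    mellin fractTail (-s) = ∫ t in Ioi (1 : ℝ), ((Int.fract t : ℝ) : ℂ) * (t : ℂ) ^ (-(s + 1)) := by
  rw [mellin]
  have : ∀ t : ℝ, (t : ℂ) ^ (-s - 1) • fractTail t =
      (Ioi (1 : ℝ)).indicator (fun t : ℝ => ((Int.fract t : ℝ) : ℂ) * (t : ℂ) ^ (-(s + 1))) t := by
    intro t
    by_cases ht : t ∈ Ioi (1 : ℝ)
    · rw [fractTail, indicator_of_mem ht, indicator_of_mem ht, smul_eq_mul, mul_comm]
      congr 2; ring
    · rw [fractTail, indicator_of_notMem ht, indicator_of_notMem ht, smul_zero]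
  simp only [this]
  rw [setIntegral_indicator measurableSet_Ioi]
  congr 2
  ext x; simp only [mem_inter_iff, mem_Ioi, and_iff_right_iff_imp]; intro h; linarith

lemma norm_mellin_fractTail_le {s : ℂ} (hs : 0 < s.re) : ‖mellin fractTail (-s)‖ ≤ 1 / s.re := by
  rw [mellin_fractTail_eq]
  have hint : IntegrableOn (fun t : ℝ => t ^ (-s.re - 1)) (Ioi 1) :=
    integrableOn_Ioi_rpow_of_lt (by linarith) zero_lt_one
  have hval : ∫ t in Ioi (1 : ℝ), t ^ (-s.re - 1) = 1 / s.re := by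
    rw [integral_Ioi_rpow_of_lt (by linarith) zero_lt_one, Real.one_rpow]
    have := hs.ne'
    have h2 : -s.re - 1 + 1 = -s.re := by ring
    rw [h2]; field_simp
  rw [← hval]
  refine norm_integral_le_of_norm_le hint ?_
  rw [ae_restrict_iff' measurableSet_Ioi]
  refine Eventually.of_forall fun t ht => ?_
  have ht0 : 0 < t := zero_lt_one.trans ht
  rw [norm_mul, norm_real, Real.norm_eq_abs, Int.abs_fract, norm_cpow_eq_rpow_re_of_pos ht0]
  have : (-(s + 1)).re = -s.re - 1 := by simp; ring
  rw [this]
  exact mul_le_of_le_one_left (by positivity) (Int.fract_lt_one t).le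

lemma riemannZeta₁_eq_of_one_lt_re {s : ℂ} (hs : 1 < s.re) :
    riemannZeta₁ s = s - s * (s - 1) * mellin fractTail (-s) := by
  have hs1 : s - 1 ≠ 0 := by
    intro h; rw [sub_eq_zero] at h; simp [h] at hs
  have hs0 : s ≠ 0 := by rintro rfl; simp at hs; linarith
  have hL : riemannZeta s = s * ∫ t in Ioi (1 : ℝ), ((⌊t⌋₊ : ℝ) : ℂ) * (t : ℂ) ^ (-(s + 1)) := by
    have h1 := LSeries_eq_mul_integral_of_nonneg (fun _ => (1 : ℝ)) (r := 1) zero_le_one hs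
      (by simpa using Asymptotics.isBigO_refl _ _) (fun _ => zero_le_one)
    have h2 : LSeries (fun _ => ((1 : ℝ) : ℂ)) s = riemannZeta s := by
      rw [← LSeries_one_eq_riemannZeta hs]
      congr 1
    rw [h2] at h1
    simpa using h1
  have hi1 : IntegrableOn (fun t : ℝ => (t : ℂ) * (t : ℂ) ^ (-(s + 1))) (Ioi 1) := by
    have := integrableOn_Ioi_cpow_of_lt (a := -s) (by simpa using hs) zero_lt_one
    refine this.congr_fun (fun t ht => ?_) measurableSet_Ioi
    have ht0 : (t : ℂ) ≠ 0 := by exact_mod_cast (zero_lt_one.trans ht).ne'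
    simp only
    rw [neg_add, cpow_add _ _ ht0, cpow_neg_one]
    field_simp
  have hmeas : ∀ {g : ℝ → ℝ}, Measurable g → AEStronglyMeasurable
      (fun t : ℝ => (g t : ℂ) * (t : ℂ) ^ (-(s + 1))) (volume.restrict (Ioi 1)) := by
    intro g hg
    exact ((measurable_ofReal.comp hg).mul (measurable_ofReal.pow_const _)).aestronglyMeasurable
  have hi2 : IntegrableOn (fun t : ℝ => ((⌊t⌋₊ : ℝ) : ℂ) * (t : ℂ) ^ (-(s + 1))) (Ioi 1) := by
    refine Integrable.mono hi1 (hmeas (by fun_prop)) ?_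
    rw [ae_restrict_iff' measurableSet_Ioi]
    refine Eventually.of_forall fun t ht => ?_
    have ht0 : 0 < t := zero_lt_one.trans ht
    rw [norm_mul, norm_mul]
    gcongr
    rw [norm_real, norm_real, Real.norm_eq_abs, Real.norm_eq_abs, abs_of_pos ht0,
      abs_of_nonneg (by positivity)]
    exact Nat.floor_le ht0.le
  have hsplit : mellin fractTail (-s) = 1 / (s - 1) - riemannZeta s / s := by
    have hval : ∫ t in Ioi (1 : ℝ), (t : ℂ) * (t : ℂ) ^ (-(s + 1)) = 1 / (s - 1) := by
      have := integral_Ioi_cpow_of_lt (a := -s) (by simpa using hs) zero_lt_one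
      rw [ofReal_one, one_cpow] at this
      rw [setIntegral_congr_fun measurableSet_Ioi (g := fun t : ℝ => (t : ℂ) ^ (-s)), this]
      · have h3 : -s + 1 = -(s - 1) := by ring
        rw [h3, neg_div_neg_eq]
      · intro t ht
        have ht0 : (t : ℂ) ≠ 0 := by exact_mod_cast (zero_lt_one.trans ht).ne'
        simp only
        rw [neg_add, cpow_add _ _ ht0, cpow_neg_one]
        field_simp
    rw [mellin_fractTail_eq, hL, mul_div_cancel_left₀ _ hs0, ← hval, ← integral_sub hi1 hi2]
    refine setIntegral_congr_fun measurableSet_Ioi fun t ht => ?_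
    have ht0 : 0 < t := zero_lt_one.trans ht
    rw [← sub_mul, ← ofReal_sub, ← Int.self_sub_floor, natCast_floor_eq_intCast_floor ht0.le]
  rw [hsplit, riemannZeta_eq_inv_sub_mul (sub_ne_zero.mp hs1)]
  field_simp
  ring

lemma riemannZeta₁_eq {s : ℂ} (hs : 0 < s.re) :
    riemannZeta₁ s = s - s * (s - 1) * mellin fractTail (-s) := by
  set U : Set ℂ := reLm ⁻¹' Ioi (0 : ℝ) with hU
  have hmem : ∀ z : ℂ, z ∈ U ↔ 0 < z.re := fun z => Iff.rfl
  have hopen : IsOpen U := isOpen_Ioi.preimage continuous_re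
  have hdiff : DifferentiableOn ℂ (fun s => s - s * (s - 1) * mellin fractTail (-s)) U := by
    intro z hz
    have h1 : DifferentiableAt ℂ (mellin fractTail) (-z) :=
      differentiableAt_mellin_fractTail (by simpa using (hmem z).mp hz)
    have h2 : DifferentiableAt ℂ (fun s => mellin fractTail (-s)) z :=
      DifferentiableAt.comp (g := mellin fractTail) z h1 differentiableAt_id.neg
    exact (differentiableAt_id.sub ((differentiableAt_id.mul (differentiableAt_id.sub_const 1)).mul
      h2)).differentiableWithinAt
  refine AnalyticOnNhd.eqOn_of_preconnected_of_eventuallyEq (z₀ := 2)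
    (differentiable_riemannZeta₁.differentiableOn.analyticOnNhd hopen) (hdiff.analyticOnNhd hopen)
    ((convex_Ioi (0 : ℝ)).linear_preimage reLm).isPreconnected (by rw [hmem]; simp) ?_ hs
  have : {z : ℂ | 1 < z.re} ∈ 𝓝 (2 : ℂ) :=
    (isOpen_Ioi.preimage continuous_re).mem_nhds (by simp)
  filter_upwards [this] with z hz
  exact riemannZeta₁_eq_of_one_lt_re hz

/-- Exponential growth is cruder than the true order of growth, but all that the strip needs: it
bounds `log ‖riemannZeta₁‖` linearly. -/
lemma norm_riemannZeta₁_le {s : ℂ} (hs : 1 / 2 ≤ s.re) :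
    ‖riemannZeta₁ s‖ ≤ Real.exp (2 * (1 + ‖s‖)) := by
  have hs0 : 0 < s.re := by linarith
  have hM : ‖mellin fractTail (-s)‖ ≤ 2 := by
    refine (norm_mellin_fractTail_le hs0).trans ?_
    rw [div_le_iff₀ hs0]; linarith
  have h1 : ‖s - 1‖ ≤ ‖s‖ + 1 := by simpa using norm_sub_le s 1
  have h2 : ‖riemannZeta₁ s‖ ≤ ‖s‖ + ‖s‖ * (‖s‖ + 1) * 2 := by
    rw [riemannZeta₁_eq hs0]
    refine (norm_sub_le _ _).trans ?_
    rw [norm_mul, norm_mul]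
    gcongr
  have h3 : 1 + (1 + ‖s‖) ≤ Real.exp (1 + ‖s‖) := by
    linarith [Real.add_one_le_exp (1 + ‖s‖)]
  have h4 : Real.exp (2 * (1 + ‖s‖)) = Real.exp (1 + ‖s‖) * Real.exp (1 + ‖s‖) := by
    rw [← Real.exp_add]; ring_nf
  have h5 : 1 + (1 + ‖s‖) + (1 + ‖s‖) ^ 2 / 2 ≤ Real.exp (1 + ‖s‖) := by
    have := Real.quadratic_le_exp_of_nonneg (by positivity : 0 ≤ 1 + ‖s‖)
    linarith
  have h6 := norm_nonneg s
  rw [h4]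
  nlinarith

/-! ### The zeta function to the right of its pole -/

/-- A Dirichlet series with coefficients of modulus at most `1` is bounded by `1 + O(2 ^ (-σ))`. -/
lemma exists_norm_LSeries_le : ∃ K : ℝ, 0 ≤ K ∧ ∀ (a : ℕ → ℂ), (∀ n, ‖a n‖ ≤ 1) → ∀ s : ℂ,
    3 / 2 ≤ s.re → ‖LSeries a s‖ ≤ 1 + K * 2 ^ (-s.re) := by
  have hsum : Summable fun n : ℕ => 1 / (n : ℝ) ^ (3 / 2 : ℝ) :=
    Real.summable_one_div_nat_rpow.mpr (by norm_num)
  refine ⟨2 ^ (3 / 2 : ℝ) * ∑' n : ℕ, 1 / (n : ℝ) ^ (3 / 2 : ℝ), by positivity, ?_⟩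
  intro a ha s hs
  have hone : HasSum (fun n : ℕ => if n = 1 then (1 : ℝ) else 0) 1 := hasSum_ite_eq 1 1
  have hmaj := hone.add ((hsum.hasSum).mul_left (2 ^ (3 / 2 : ℝ) * 2 ^ (-s.re)))
  refine (tsum_of_norm_bounded hmaj fun n => ?_).trans (le_of_eq (by ring))
  rcases eq_or_ne n 0 with rfl | hn
  · simp only [LSeries.term_zero, norm_zero]; positivity
  rw [LSeries.norm_term_eq, if_neg hn]
  have hn0 : 0 < (n : ℝ) := by positivity
  have h1 : ‖a n‖ / (n : ℝ) ^ s.re ≤ 1 / (n : ℝ) ^ s.re := by gcongr; exact ha n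
  refine h1.trans ?_
  rcases eq_or_ne n 1 with rfl | hn1
  · simp; positivity
  have hn2 : (2 : ℝ) ≤ n := by
    have : 2 ≤ n := by omega
    exact_mod_cast this
  rw [if_neg hn1, zero_add]
  have e1 : 1 / (n : ℝ) ^ s.re = (n : ℝ) ^ (-(s.re - 3 / 2)) * (1 / (n : ℝ) ^ (3 / 2 : ℝ)) := by
    rw [one_div, one_div, ← Real.rpow_neg hn0.le, ← Real.rpow_neg hn0.le, ← Real.rpow_add hn0]
    congr 1; ring
  have e2 : (2 : ℝ) ^ (3 / 2 : ℝ) * 2 ^ (-s.re) = 2 ^ (-(s.re - 3 / 2)) := by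
    rw [← Real.rpow_add two_pos]; congr 1; ring
  rw [e1, e2]
  gcongr ?_ * _
  exact Real.rpow_le_rpow_of_nonpos two_pos hn2 (by linarith)

open scoped ArithmeticFunction.Moebius in
/-- Both `ζ` and `1 / ζ` are Dirichlet series with bounded coefficients, the second one those of the
Möbius function. -/
lemma exists_norm_riemannZeta_le : ∃ K : ℝ, 0 ≤ K ∧ ∀ s : ℂ, 3 / 2 ≤ s.re →
    ‖riemannZeta s‖ ≤ 1 + K * 2 ^ (-s.re) ∧ ‖(riemannZeta s)⁻¹‖ ≤ 1 + K * 2 ^ (-s.re) := by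
  obtain ⟨K, hK, h⟩ := exists_norm_LSeries_le
  refine ⟨K, hK, fun s hs => ⟨?_, ?_⟩⟩
  · rw [← LSeries_one_eq_riemannZeta (by linarith)]
    exact h _ (fun n => by simp) s hs
  · have h1 := LSeries_one_mul_Lseries_moebius (s := s) (by linarith)
    rw [LSeries_one_eq_riemannZeta (by linarith)] at h1
    rw [inv_eq_of_mul_eq_one_right h1]
    refine h _ (fun n => ?_) s hs
    rw [norm_intCast]
    exact_mod_cast ArithmeticFunction.abs_moebius_le_one

lemma riemannZeta_ne_zero_of_three_halves_le {s : ℂ} (hs : 3 / 2 ≤ s.re) : riemannZeta s ≠ 0 :=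
  riemannZeta_ne_zero_of_one_lt_re (by linarith)

lemma exists_abs_log_norm_riemannZeta_le : ∃ K : ℝ, 0 ≤ K ∧ ∀ s : ℂ, 3 / 2 ≤ s.re →
    |Real.log ‖riemannZeta s‖| ≤ K * 2 ^ (-s.re) := by
  obtain ⟨K, hK, h⟩ := exists_norm_riemannZeta_le
  refine ⟨K, hK, fun s hs => ?_⟩
  have hpos : 0 < ‖riemannZeta s‖ := norm_pos_iff.mpr (riemannZeta_ne_zero_of_three_halves_le hs)
  obtain ⟨h1, h2⟩ := h s hs
  have hlog : Real.log (1 + K * 2 ^ (-s.re)) ≤ K * 2 ^ (-s.re) := by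
    have := Real.log_le_sub_one_of_pos (show 0 < 1 + K * (2 : ℝ) ^ (-s.re) by positivity)
    linarith
  rw [abs_le]
  constructor
  · have := Real.log_le_log (by rw [norm_inv]; positivity) h2
    rw [norm_inv, Real.log_inv] at this
    linarith
  · exact (Real.log_le_log hpos h1).trans hlog

/-- The integral of `log ‖ζ‖` against `1 / cosh (π t)` along the vertical line of abscissa `σ`. -/
noncomputable def zetaLineIntegral (σ : ℝ) : ℝ :=
  ∫ t : ℝ, Real.log ‖riemannZeta (σ + t * I)‖ / Real.cosh (π * t)

lemma norm_riemannZeta_neg_im (σ t : ℝ) :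
    ‖riemannZeta (σ - t * I)‖ = ‖riemannZeta (σ + t * I)‖ := by
  have h : (σ : ℂ) - t * I = (starRingEnd ℂ) (σ + t * I) := by simp [sub_eq_add_neg]
  rw [h, riemannZeta_conj, norm_conj]

lemma integral_neg_line (g : ℂ → ℝ) (c : ℝ) :
    ∫ t : ℝ, g (c - t * I) / Real.cosh (π * t) = ∫ t : ℝ, g (c + t * I) / Real.cosh (π * t) := by
  rw [← integral_neg_eq_self]
  congr 1 with t
  simp [sub_neg_eq_add]

/-- The mean value property of `log ‖ζ‖` in the strip of width `1` centred at `σ`. -/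
lemma zetaLineIntegral_add {σ : ℝ} (hσ : 2 ≤ σ) :
    zetaLineIntegral (σ - 1 / 2) + zetaLineIntegral (σ + 1 / 2) =
      2 * Real.log ‖riemannZeta σ‖ := by
  obtain ⟨K, hK, h⟩ := exists_norm_riemannZeta_le
  have hre : ∀ z : ℂ, |z.re| ≤ 1 / 2 → 3 / 2 ≤ ((σ : ℂ) + z).re := by
    intro z hz
    have := (abs_le.mp hz).1
    simp; linarith
  have hbound : ∀ z : ℂ, |z.re| ≤ 1 / 2 → 1 + K * 2 ^ (-((σ : ℂ) + z).re) ≤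
      Real.exp (K * (1 + |z.im|)) := by
    intro z hz
    have h1 : (2 : ℝ) ^ (-((σ : ℂ) + z).re) ≤ 1 :=
      Real.rpow_le_one_of_one_le_of_nonpos one_le_two (by linarith [hre z hz])
    calc 1 + K * (2 : ℝ) ^ (-((σ : ℂ) + z).re) ≤ K * (1 + |z.im|) + 1 := by
          nlinarith [abs_nonneg z.im, mul_nonneg hK (abs_nonneg z.im)]
      _ ≤ _ := Real.add_one_le_exp _
  have hmv := strip_mean_value (f := fun z => riemannZeta (σ + z)) hK ?_
    (fun z hz => (h _ (hre z hz)).1.trans (hbound z hz))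
    (fun z hz => riemannZeta_ne_zero_of_three_halves_le (hre z hz))
    (fun z hz => (h _ (hre z hz)).2.trans (hbound z hz))
  · simp only [add_zero] at hmv
    rw [← hmv, add_comm]
    congr 1
    · rw [zetaLineIntegral]
      congr 1 with t
      push_cast
      ring_nf
    · rw [zetaLineIntegral, ← integral_neg_line (fun s => Real.log ‖riemannZeta s‖)]
      congr 1 with t
      push_cast
      ring_nf
  · intro z hz
    have hne : (σ : ℂ) + z ≠ 1 := by
      intro h1
      have h2 := hre z hz
      rw [h1, one_re] at h2
      norm_num at h2
    exact (analyticOn_riemannZeta _ hne).comp_of_eq (by fun_prop) rfl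

lemma tendsto_zetaLineIntegral_atTop :
    Tendsto (fun n : ℕ => zetaLineIntegral (n + 3 / 2)) atTop (𝓝 0) := by
  obtain ⟨K, hK, h⟩ := exists_abs_log_norm_riemannZeta_le
  have hI := integrable_linear_div_cosh Real.pi_pos 1
  have hb : ∀ n : ℕ, |zetaLineIntegral (n + 3 / 2)| ≤
      (K * ∫ t : ℝ, 1 * (1 + |t|) / Real.cosh (π * t)) * (1 / 2) ^ n := by
    intro n
    rw [zetaLineIntegral, ← Real.norm_eq_abs, ← integral_const_mul, ← integral_mul_const]
    refine norm_integral_le_of_norm_le ((hI.const_mul K).mul_const _) (Eventually.of_forall ?_)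
    intro t
    have hre : ((((n + 3 / 2 : ℝ)) : ℂ) + t * I).re = n + 3 / 2 := by simp
    have h1 := h (((n + 3 / 2 : ℝ) : ℂ) + t * I) (by rw [hre]; linarith [n.cast_nonneg (α := ℝ)])
    rw [hre] at h1
    have h2 : (2 : ℝ) ^ (-((n : ℝ) + 3 / 2)) ≤ (1 / 2) ^ n := by
      rw [one_div, inv_pow, ← Real.rpow_natCast, ← Real.rpow_neg two_pos.le]
      exact Real.rpow_le_rpow_of_exponent_le one_le_two (by linarith)
    rw [norm_div, Real.norm_eq_abs, Real.norm_eq_abs, abs_of_pos (Real.cosh_pos _)]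
    calc _ ≤ K * (1 / 2) ^ n / Real.cosh (π * t) := by
          have := Real.cosh_pos (π * t)
          gcongr
          exact h1.trans (by gcongr)
      _ ≤ K * (1 * (1 + |t|) / Real.cosh (π * t)) * (1 / 2) ^ n := by
          have h3 := Real.cosh_pos (π * t)
          rw [mul_div_assoc', div_mul_eq_mul_div]
          gcongr ?_ / _
          have : 0 ≤ K * (1 / 2) ^ n * |t| := by positivity
          nlinarith
  apply squeeze_zero_norm hb
  have := tendsto_pow_atTop_nhds_zero_of_lt_one (r := (1 / 2 : ℝ)) (by norm_num) (by norm_num)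
  simpa using this.const_mul (K * ∫ t : ℝ, 1 * (1 + |t|) / Real.cosh (π * t))

lemma norm_riemannZeta_natCast {n : ℕ} (hn : 2 ≤ n) :
    ‖riemannZeta ((n : ℝ) : ℂ)‖ = (riemannZeta (n : ℂ)).re := by
  have h1 : (1 : ℝ) < n := by exact_mod_cast hn
  have h2 := riemannZeta_im_eq_zero_of_one_lt h1
  have h3 := riemannZeta_re_pos_of_one_lt h1
  rw [← re_add_im (riemannZeta ((n : ℝ) : ℂ)), h2]
  simp only [ofReal_zero, zero_mul, add_zero, norm_real, Real.norm_eq_abs]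
  rw [abs_of_pos h3, ofReal_natCast]

lemma summable_log_riemannZeta : Summable fun n : ℕ =>
    (-1 : ℝ) ^ ((n + 2) + 1) * Real.log (riemannZeta ((n + 2 : ℕ) : ℂ)).re := by
  obtain ⟨K, hK, h⟩ := exists_abs_log_norm_riemannZeta_le
  refine Summable.of_norm_bounded (g := fun n : ℕ => K * (1 / 2) ^ n)
    ((summable_geometric_of_lt_one (by norm_num) (by norm_num)).mul_left K) fun n => ?_
  have h1 := h (((n + 2 : ℕ) : ℝ) : ℂ)
    (by simp only [ofReal_re]; push_cast; linarith [n.cast_nonneg (α := ℝ)])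
  rw [norm_riemannZeta_natCast (by omega), ofReal_re] at h1
  rw [norm_mul, norm_pow, norm_neg, norm_one, one_pow, one_mul, Real.norm_eq_abs]
  refine h1.trans ?_
  gcongr
  rw [one_div, inv_pow, ← Real.rpow_natCast, ← Real.rpow_neg two_pos.le]
  exact Real.rpow_le_rpow_of_exponent_le one_le_two (by push_cast; linarith)

/-- The mean values over the strips centred at `n = 2, 3, …` telescope with alternating signs. -/
lemma two_mul_tsum_log_riemannZeta :
    2 * ∑' n : ℕ, (-1 : ℝ) ^ ((n + 2) + 1) * Real.log (riemannZeta ((n + 2 : ℕ) : ℂ)).re =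
      -zetaLineIntegral (3 / 2) := by
  have hpart : ∀ N : ℕ, 2 * ∑ n ∈ Finset.range N,
      (-1 : ℝ) ^ ((n + 2) + 1) * Real.log (riemannZeta ((n + 2 : ℕ) : ℂ)).re =
      (-1) ^ N * zetaLineIntegral (N + 3 / 2) - zetaLineIntegral (3 / 2) := by
    intro N
    induction N with
    | zero => simp
    -- `2 log ζ(N + 2)` is the sum of the integrals over the lines `N + 3 / 2` and `N + 5 / 2`
    | succ N ih =>
      have h := zetaLineIntegral_add (σ := ((N + 2 : ℕ) : ℝ))
        (by push_cast; linarith [N.cast_nonneg (α := ℝ)])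
      rw [norm_riemannZeta_natCast (by omega)] at h
      rw [Finset.sum_range_succ, mul_add, ih]
      have e1 : ((N + 2 : ℕ) : ℝ) - 1 / 2 = N + 3 / 2 := by push_cast; ring
      have e2 : ((N + 2 : ℕ) : ℝ) + 1 / 2 = ((N + 1 : ℕ) : ℝ) + 3 / 2 := by push_cast; ring
      rw [e1, e2] at h
      have e3 : (-1 : ℝ) ^ ((N + 2) + 1) = -(-1) ^ N := by ring
      have e4 : (-1 : ℝ) ^ (N + 1) = -(-1) ^ N := by ring
      rw [e3, e4]
      linear_combination (-(-1 : ℝ) ^ N) * (-h)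
  have hlim := (summable_log_riemannZeta.hasSum.tendsto_sum_nat).const_mul 2
  simp only [hpart] at hlim
  refine tendsto_nhds_unique hlim ?_
  have hz : Tendsto (fun N : ℕ => (-1 : ℝ) ^ N * zetaLineIntegral (N + 3 / 2)) atTop (𝓝 0) := by
    refine squeeze_zero_norm (fun N => ?_) (by simpa using tendsto_zetaLineIntegral_atTop.norm)
    simp [norm_mul]
  simpa using hz.sub_const (zetaLineIntegral (3 / 2))

/-! ### The integral of `log ‖1 / 2 + i t‖` -/

lemma norm_sin_sq (z : ℂ) : ‖sin z‖ ^ 2 = Real.sin z.re ^ 2 + Real.sinh z.im ^ 2 := by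
  have h : sin z = ((Real.sin z.re * Real.cosh z.im : ℝ) : ℂ) +
      ((Real.cos z.re * Real.sinh z.im : ℝ) : ℂ) * I := by
    push_cast; exact sin_eq z
  rw [h, ← Complex.normSq_eq_norm_sq, normSq_add_mul_I]
  linear_combination Real.sin z.re ^ 2 * Real.cosh_sq z.im +
    Real.sinh z.im ^ 2 * Real.sin_sq_add_cos_sq z.re

lemma norm_cos_sq (z : ℂ) : ‖cos z‖ ^ 2 = Real.cos z.re ^ 2 + Real.sinh z.im ^ 2 := by
  have h : cos z = ((Real.cos z.re * Real.cosh z.im : ℝ) : ℂ) +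
      ((-(Real.sin z.re * Real.sinh z.im) : ℝ) : ℂ) * I := by
    push_cast; rw [cos_eq z]; ring
  rw [h, ← Complex.normSq_eq_norm_sq, normSq_add_mul_I]
  linear_combination Real.cos z.re ^ 2 * Real.cosh_sq z.im +
    Real.sinh z.im ^ 2 * Real.sin_sq_add_cos_sq z.re

/-- `tan (π z / 2) / z`, completed at `z = 0`. The numerator has modulus `1` on the boundary of
the strip, so this function turns the mean value property into the value of an integral. -/
noncomputable def tanQuot (z : ℂ) : ℂ :=
  dslope (fun z => sin (π / 2 * z)) 0 z / cos (π / 2 * z)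

lemma tanQuot_of_ne {z : ℂ} (hz : z ≠ 0) : tanQuot z = sin (π / 2 * z) / z / cos (π / 2 * z) := by
  rw [tanQuot, dslope_of_ne _ hz, slope_def_field]
  simp

lemma tanQuot_zero : tanQuot 0 = π / 2 := by
  have h : HasDerivAt (fun z : ℂ => sin (π / 2 * z)) (π / 2) 0 := by
    have h1 : HasDerivAt (fun z : ℂ => (π : ℂ) / 2 * z) (π / 2) 0 := by
      simpa using (hasDerivAt_id (0 : ℂ)).const_mul ((π : ℂ) / 2)
    have h2 := (hasDerivAt_sin (π / 2 * (0 : ℂ))).comp (0 : ℂ) h1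
    simpa [Function.comp_def] using h2
  rw [tanQuot, dslope_same, h.deriv]
  simp

lemma re_pi_half_mul (z : ℂ) : ((π : ℂ) / 2 * z).re = π / 2 * z.re := by
  rw [show (π : ℂ) / 2 = ((π / 2 : ℝ) : ℂ) by push_cast; rfl, re_ofReal_mul]

lemma im_pi_half_mul (z : ℂ) : ((π : ℂ) / 2 * z).im = π / 2 * z.im := by
  rw [show (π : ℂ) / 2 = ((π / 2 : ℝ) : ℂ) by push_cast; rfl, im_ofReal_mul]

lemma norm_sin_sq_le_norm_cos_sq {z : ℂ} (hz : |z.re| ≤ 1 / 2) :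
    ‖sin (π / 2 * z)‖ ^ 2 ≤ ‖cos (π / 2 * z)‖ ^ 2 ∧ 1 / 2 ≤ ‖cos (π / 2 * z)‖ ^ 2 := by
  rw [norm_sin_sq, norm_cos_sq, re_pi_half_mul, im_pi_half_mul]
  have hpi := Real.pi_pos
  obtain ⟨h1, h2⟩ := abs_le.mp hz
  have hc : 0 ≤ Real.cos (2 * (π / 2 * z.re)) :=
    Real.cos_nonneg_of_mem_Icc ⟨by nlinarith, by nlinarith⟩
  rw [Real.cos_two_mul] at hc
  have := Real.sin_sq_add_cos_sq (π / 2 * z.re)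
  constructor <;> nlinarith [sq_nonneg (Real.sinh (π / 2 * z.im))]

lemma cos_pi_half_mul_ne_zero {z : ℂ} (hz : |z.re| ≤ 1 / 2) : cos (π / 2 * z) ≠ 0 := by
  intro h
  have := (norm_sin_sq_le_norm_cos_sq hz).2
  rw [h] at this
  norm_num at this

lemma sin_pi_half_mul_ne_zero {z : ℂ} (hz : |z.re| ≤ 1 / 2) (hz0 : z ≠ 0) :
    sin (π / 2 * z) ≠ 0 := by
  intro h
  have h1 := norm_sin_sq (π / 2 * z)
  rw [h, norm_zero, re_pi_half_mul, im_pi_half_mul] at h1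
  have hpi := Real.pi_pos
  have hs : Real.sinh (π / 2 * z.im) = 0 := by
    nlinarith [sq_nonneg (Real.sinh (π / 2 * z.im)), sq_nonneg (Real.sin (π / 2 * z.re))]
  have hs' : Real.sin (π / 2 * z.re) = 0 := by
    nlinarith [sq_nonneg (Real.sinh (π / 2 * z.im)), sq_nonneg (Real.sin (π / 2 * z.re))]
  obtain ⟨h2, h3⟩ := abs_le.mp hz
  rw [Real.sinh_eq_zero] at hs
  rw [Real.sin_eq_zero_iff_of_lt_of_lt (by nlinarith) (by nlinarith)] at hs'
  apply hz0
  apply Complex.ext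
  · simpa [hpi.ne'] using hs'
  · simpa [hpi.ne'] using hs

lemma analyticAt_tanQuot {z : ℂ} (hz : |z.re| ≤ 1 / 2) : AnalyticAt ℂ tanQuot z := by
  have h1 : Differentiable ℂ (dslope (fun z : ℂ => sin (π / 2 * z)) 0) := by
    rw [← differentiableOn_univ, differentiableOn_dslope univ_mem, differentiableOn_univ]
    fun_prop
  exact (h1.analyticAt z).div (by fun_prop) (cos_pi_half_mul_ne_zero hz)

lemma tanQuot_ne_zero {z : ℂ} (hz : |z.re| ≤ 1 / 2) : tanQuot z ≠ 0 := by
  rcases eq_or_ne z 0 with rfl | hz0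
  · rw [tanQuot_zero]; simp
  · rw [tanQuot_of_ne hz0]
    exact div_ne_zero (div_ne_zero (sin_pi_half_mul_ne_zero hz hz0) hz0)
      (cos_pi_half_mul_ne_zero hz)

/-- Near the origin the bounds come from compactness, away from it from the explicit formula. -/
lemma exists_tanQuot_growth : ∃ C : ℝ, 0 ≤ C ∧ ∀ z : ℂ, |z.re| ≤ 1 / 2 →
    ‖tanQuot z‖ ≤ Real.exp (C * (1 + |z.im|)) ∧ ‖(tanQuot z)⁻¹‖ ≤ Real.exp (C * (1 + |z.im|)) := by
  set S : Set ℂ := closedBall (0 : ℂ) 1 ∩ reLm ⁻¹' Icc (-(1 / 2) : ℝ) (1 / 2) with hS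
  have hmem : ∀ z ∈ S, |z.re| ≤ 1 / 2 := fun z hz => abs_le.mpr hz.2
  have hcomp : IsCompact S :=
    (isCompact_closedBall _ _).inter_right (isClosed_Icc.preimage continuous_re)
  have hcont : ContinuousOn tanQuot S := fun z hz =>
    (analyticAt_tanQuot (hmem z hz)).continuousAt.continuousWithinAt
  obtain ⟨M₁, hM₁⟩ := hcomp.exists_bound_of_continuousOn hcont
  obtain ⟨M₂, hM₂⟩ := hcomp.exists_bound_of_continuousOn
    (hcont.inv₀ fun z hz => tanQuot_ne_zero (hmem z hz))
  refine ⟨2 + |M₁| + |M₂|, by positivity, fun z hz => ?_⟩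
  have hexp : ∀ M : ℝ, M ≤ (2 + |M₁| + |M₂|) * (1 + |z.im|) →
      M ≤ Real.exp ((2 + |M₁| + |M₂|) * (1 + |z.im|)) := fun M hM => by
    linarith [Real.add_one_le_exp ((2 + |M₁| + |M₂|) * (1 + |z.im|))]
  have habs : 0 ≤ (2 + |M₁| + |M₂|) * |z.im| := by positivity
  by_cases hz1 : ‖z‖ ≤ 1
  · have hzS : z ∈ S := ⟨by simpa using hz1, abs_le.mp hz⟩
    refine ⟨(hM₁ z hzS).trans (hexp _ ?_), (hM₂ z hzS).trans (hexp _ ?_)⟩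
    · linarith [le_abs_self M₁, abs_nonneg M₂]
    · linarith [le_abs_self M₂, abs_nonneg M₁]
  · push Not at hz1
    have hz0 : z ≠ 0 := by rintro rfl; simp at hz1; linarith
    have hcpos : 0 < ‖cos (π / 2 * z)‖ := norm_pos_iff.mpr (cos_pi_half_mul_ne_zero hz)
    have hspos : 0 < ‖sin (π / 2 * z)‖ := norm_pos_iff.mpr (sin_pi_half_mul_ne_zero hz hz0)
    have hzpos : 0 < ‖z‖ := by linarith
    rw [tanQuot_of_ne hz0, norm_inv, norm_div, norm_div]
    constructor
    · have h1 : ‖sin (π / 2 * z)‖ ≤ ‖cos (π / 2 * z)‖ :=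
        (sq_le_sq₀ hspos.le hcpos.le).mp (norm_sin_sq_le_norm_cos_sq hz).1
      have h2 : ‖sin (π / 2 * z)‖ / ‖z‖ / ‖cos (π / 2 * z)‖ ≤ 1 := by
        rw [div_div, div_le_one (by positivity)]
        nlinarith
      exact h2.trans (Real.one_le_exp (by positivity))
    · -- here `|Im z| > 1 / 2`, so `sinh` is bounded below
      have hnorm : ‖z‖ ^ 2 = z.re ^ 2 + z.im ^ 2 := by
        rw [← Complex.normSq_eq_norm_sq, normSq_apply]; ring
      have hre2 : z.re ^ 2 ≤ 1 / 4 := by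
        have := sq_le_sq' (abs_le.mp hz).1 (abs_le.mp hz).2
        linarith
      have him2 : 3 / 4 ≤ z.im ^ 2 := by nlinarith
      have hsinh : 1 ≤ Real.sinh (π / 2 * z.im) ^ 2 := by
        have h1 : |π / 2 * z.im| ≤ |Real.sinh (π / 2 * z.im)| := by
          rw [Real.abs_sinh]; exact Real.self_le_sinh_iff.mpr (abs_nonneg _)
        have h2 := sq_le_sq.mpr h1
        have h3 : 9 / 4 ≤ (π / 2) ^ 2 := by nlinarith [Real.pi_gt_three]
        nlinarith
      have hcs : ‖cos (π / 2 * z)‖ ≤ 2 * ‖sin (π / 2 * z)‖ := by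
        refine (sq_le_sq₀ hcpos.le (by positivity)).mp ?_
        rw [mul_pow, norm_sin_sq, norm_cos_sq, re_pi_half_mul, im_pi_half_mul]
        nlinarith [Real.cos_sq_le_one (π / 2 * z.re), sq_nonneg (Real.sin (π / 2 * z.re))]
      have hz2 : ‖z‖ ≤ 1 / 2 + |z.im| := (norm_le_abs_re_add_abs_im z).trans (by linarith)
      refine le_trans ?_ (hexp (2 * (1 + |z.im|)) ?_)
      · rw [inv_div, div_div_eq_mul_div, div_le_iff₀ hspos]
        calc ‖cos (π / 2 * z)‖ * ‖z‖ ≤ (2 * ‖sin (π / 2 * z)‖) * (1 + |z.im|) := by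
              gcongr; linarith
          _ = _ := by ring
      · nlinarith [abs_nonneg M₁, abs_nonneg M₂, abs_nonneg z.im]

lemma log_norm_tanQuot_boundary {z : ℂ} (hz : |z.re| = 1 / 2) :
    Real.log ‖tanQuot z‖ = -Real.log ‖z‖ := by
  have hz0 : z ≠ 0 := by rintro rfl; norm_num at hz
  have hsc : ‖sin (π / 2 * z)‖ = ‖cos (π / 2 * z)‖ := by
    rw [← sq_eq_sq₀ (norm_nonneg _) (norm_nonneg _), norm_sin_sq, norm_cos_sq, re_pi_half_mul]
    congr 1
    have h4 : π / 2 * (1 / 2) = π / 4 := by ring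
    rcases (abs_eq (by norm_num)).mp hz with h | h
    · rw [h, h4, Real.sin_pi_div_four, Real.cos_pi_div_four]
    · rw [h, mul_neg, h4, Real.sin_neg, Real.cos_neg, neg_sq, Real.sin_pi_div_four,
        Real.cos_pi_div_four]
  have hcpos : ‖cos (π / 2 * z)‖ ≠ 0 := norm_ne_zero_iff.mpr (cos_pi_half_mul_ne_zero hz.le)
  rw [tanQuot_of_ne hz0, norm_div, norm_div, hsc, div_right_comm, div_self hcpos, one_div,
    Real.log_inv]

/-- The integral of `log ‖1 / 2 + i t‖` against `1 / cosh (π t)`, which accounts for the factor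
`s - 1` that removes the pole of `ζ`. -/
lemma integral_log_norm_half_line :
    Integrable (fun t : ℝ => Real.log ‖(1 / 2 + t * I : ℂ)‖ / Real.cosh (π * t)) ∧
    ∫ t : ℝ, Real.log ‖(1 / 2 + t * I : ℂ)‖ / Real.cosh (π * t) = -Real.log (π / 2) := by
  obtain ⟨C, hC, h⟩ := exists_tanQuot_growth
  have h1 := strip_mean_value hC (fun z hz => analyticAt_tanQuot hz) (fun z hz => (h z hz).1)
    (fun z hz => tanQuot_ne_zero hz) (fun z hz => (h z hz).2)
  have h2 := (strip_jensen hC (fun z hz => analyticAt_tanQuot hz) (fun z hz => (h z hz).1)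
    (tanQuot_ne_zero (by simp))).1
  have e1 : ∀ t : ℝ, Real.log ‖tanQuot (1 / 2 + t * I)‖ = -Real.log ‖(1 / 2 + t * I : ℂ)‖ :=
    fun t => log_norm_tanQuot_boundary (by norm_num)
  have e2 : ∀ t : ℝ, Real.log ‖tanQuot (-(1 / 2 + t * I))‖ = -Real.log ‖(1 / 2 + t * I : ℂ)‖ := by
    intro t
    rw [log_norm_tanQuot_boundary (by norm_num), norm_neg]
  simp only [e1, e2, neg_div, integral_neg] at h1 h2
  refine ⟨by simpa using h2.neg, ?_⟩
  have h3 : Real.log ‖tanQuot 0‖ = Real.log (π / 2) := by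
    rw [tanQuot_zero]
    congr 1
    rw [show (π : ℂ) / 2 = ((π / 2 : ℝ) : ℂ) by push_cast; rfl, norm_real, Real.norm_eq_abs,
      abs_of_pos (by positivity)]
  rw [h3] at h1
  linarith

/-! ### The strip inequality for `(s - 1) ζ(s)` -/

/-- The analogue of `zetaLineIntegral` for the entire function `riemannZeta₁ s = (s - 1) ζ(s)`. -/
noncomputable def zeta₁LineIntegral (σ : ℝ) : ℝ :=
  ∫ t : ℝ, Real.log ‖riemannZeta₁ (σ + t * I)‖ / Real.cosh (π * t)

lemma analyticAt_riemannZeta₁ (s : ℂ) : AnalyticAt ℂ riemannZeta₁ s :=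
  differentiable_riemannZeta₁.analyticAt s

lemma analyticAt_riemannZeta₁_affine (c w z : ℂ) :
    AnalyticAt ℂ (fun z => riemannZeta₁ (c + w * z)) z :=
  (analyticAt_riemannZeta₁ _).comp_of_eq (by fun_prop) rfl

lemma riemannZeta₁_ne_zero_of_one_lt_re {s : ℂ} (hs : 1 < s.re) : riemannZeta₁ s ≠ 0 := by
  have h1 : s ≠ 1 := by rintro rfl; simp at hs
  intro h
  have := riemannZeta_eq_inv_sub_mul h1
  rw [h, mul_zero] at this
  exact riemannZeta_ne_zero_of_one_lt_re hs this

lemma riemannZeta₁_growth_affine {c w : ℝ} (hw : 0 ≤ w) {z : ℂ} (hz : |z.re| ≤ 1 / 2)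
    (hc : 1 / 2 + w / 2 ≤ c) :
    ‖riemannZeta₁ (c + w * z)‖ ≤ Real.exp (2 * (1 + c + w) * (1 + |z.im|)) := by
  have h1 := (abs_le.mp hz).1
  have hre : ((c : ℂ) + w * z).re = c + w * z.re := by simp
  refine (norm_riemannZeta₁_le (by rw [hre]; nlinarith)).trans (Real.exp_le_exp.mpr ?_)
  have h2 : ‖(c : ℂ) + w * z‖ ≤ c + w * (1 / 2 + |z.im|) := by
    refine (norm_add_le _ _).trans ?_
    rw [norm_mul, norm_real, norm_real, Real.norm_eq_abs, Real.norm_eq_abs, abs_of_nonneg hw,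
      abs_of_nonneg (by linarith : 0 ≤ c)]
    gcongr
    exact (norm_le_abs_re_add_abs_im z).trans (by linarith)
  have h3 := abs_nonneg z.im
  nlinarith [mul_nonneg hw h3]

/-- Jensen's inequality for `riemannZeta₁` in a strip of arbitrary width `w` inside
`Re s ≥ 1 / 2`. -/
lemma zeta₁_strip_jensen {c w : ℝ} (hw : 0 ≤ w) (hc : 1 / 2 + w / 2 ≤ c)
    (h0 : riemannZeta₁ c ≠ 0) :
    Integrable (fun t : ℝ =>
      Real.log ‖riemannZeta₁ (c + w * (1 / 2 + t * I))‖ / Real.cosh (π * t)) ∧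
    Integrable (fun t : ℝ =>
      Real.log ‖riemannZeta₁ (c + w * -(1 / 2 + t * I))‖ / Real.cosh (π * t)) ∧
    2 * Real.log ‖riemannZeta₁ c‖ ≤
      (∫ t : ℝ, Real.log ‖riemannZeta₁ (c + w * (1 / 2 + t * I))‖ / Real.cosh (π * t)) +
      ∫ t : ℝ, Real.log ‖riemannZeta₁ (c + w * -(1 / 2 + t * I))‖ / Real.cosh (π * t) := by
  have := strip_jensen (f := fun z => riemannZeta₁ (c + w * z)) (C := 2 * (1 + c + w))
    (by linarith) (fun z _ => analyticAt_riemannZeta₁_affine _ _ _)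
    (fun z hz => riemannZeta₁_growth_affine hw hz hc) (by simpa using h0)
  simpa only [mul_zero, add_zero] using this

lemma zeta₁LineIntegral_neg_line (c : ℝ) :
    ∫ t : ℝ, Real.log ‖riemannZeta₁ (c - t * I)‖ / Real.cosh (π * t) = zeta₁LineIntegral c :=
  integral_neg_line (fun s => Real.log ‖riemannZeta₁ s‖) c

lemma log_norm_riemannZeta₁_le {σ t : ℝ} (h1 : 1 / 2 ≤ σ) (h2 : σ ≤ 4) :
    Real.log ‖riemannZeta₁ (σ + t * I)‖ ≤ 10 * (1 + |t|) := by
  have h3 : ‖(σ : ℂ) + t * I‖ ≤ 4 + |t| := by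
    refine (norm_add_le _ _).trans ?_
    rw [norm_mul, norm_I, mul_one, norm_real, norm_real, Real.norm_eq_abs, Real.norm_eq_abs,
      abs_of_nonneg (by linarith : 0 ≤ σ)]
    linarith
  have h4 := log_norm_le_of_norm_le_exp (by positivity)
    (norm_riemannZeta₁_le (s := σ + t * I) (by simpa using h1))
  linarith [abs_nonneg t]

/-- A bound, uniform in `σ`, for the integral of `log ‖riemannZeta₁‖` over the line of abscissa `σ`
against the heavier weight `1 / cosh (π t / 2)`: it comes from the strip of width `2` whose left
edge is that line, and it controls the tails of the integrals against `1 / cosh (π t)`. -/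
lemma exists_zeta₁_heavy_bound : ∃ K : ℝ, ∀ σ : ℝ, 1 / 2 ≤ σ → σ ≤ 2 →
    Integrable (fun t : ℝ => Real.log ‖riemannZeta₁ (σ + t * I)‖ / Real.cosh (π / 2 * t)) ∧
    ∫ t : ℝ, (10 * (1 + |t|) - Real.log ‖riemannZeta₁ (σ + t * I)‖) / Real.cosh (π / 2 * t) ≤
      K := by
  have hcont : ContinuousOn (fun σ : ℝ => Real.log ‖riemannZeta₁ ((σ + 1 : ℝ) : ℂ)‖)
      (Icc (1 / 2) 2) := by
    have h1 : Continuous fun σ : ℝ => ‖riemannZeta₁ ((σ + 1 : ℝ) : ℂ)‖ :=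
      (differentiable_riemannZeta₁.continuous.comp (by fun_prop)).norm
    refine h1.continuousOn.log fun σ hσ => norm_ne_zero_iff.mpr ?_
    exact riemannZeta₁_ne_zero_of_one_lt_re (by simp only [ofReal_re]; linarith [hσ.1])
  obtain ⟨L, hL⟩ := isCompact_Icc.exists_bound_of_continuousOn hcont
  have hpi := Real.pi_pos
  have hE := integrable_linear_div_cosh hpi 20
  have hH := integrable_linear_div_cosh (half_pos hpi) 10
  refine ⟨(∫ t : ℝ, 10 * (1 + |t|) / Real.cosh (π / 2 * t)) +
    2 * (2 * L + ∫ t : ℝ, 20 * (1 + |t|) / Real.cosh (π * t)), fun σ h1 h2 => ?_⟩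
  have h0 : riemannZeta₁ ((σ + 1 : ℝ) : ℂ) ≠ 0 :=
    riemannZeta₁_ne_zero_of_one_lt_re (by simp only [ofReal_re]; linarith)
  obtain ⟨i1, i2, hle⟩ := zeta₁_strip_jensen (c := σ + 1) (w := 2) (by norm_num) (by linarith) h0
  set G : ℝ → ℝ := fun t => Real.log ‖riemannZeta₁ (σ + t * I)‖ / Real.cosh (π / 2 * t) with hG
  have e2 : ∀ t : ℝ,
      Real.log ‖riemannZeta₁ (((σ + 1 : ℝ) : ℂ) + ((2 : ℝ) : ℂ) * -(1 / 2 + t * I))‖ /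
      Real.cosh (π * t) = G (-2 * t) := by
    intro t
    rw [hG]
    simp only
    have a1 : ((σ + 1 : ℝ) : ℂ) + ((2 : ℝ) : ℂ) * -(1 / 2 + t * I) =
        σ + ((-2 * t : ℝ) : ℂ) * I := by
      push_cast; ring
    have a2 : π / 2 * (-2 * t) = -(π * t) := by ring
    rw [a1, a2, Real.cosh_neg]
  simp only [e2] at i2 hle
  have hGint : Integrable G := (integrable_comp_mul_left_iff G (by norm_num : (-2 : ℝ) ≠ 0)).mp i2
  refine ⟨hGint, ?_⟩
  have hright : ∫ t : ℝ, Real.log ‖riemannZeta₁ (((σ + 1 : ℝ) : ℂ) +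
      ((2 : ℝ) : ℂ) * (1 / 2 + t * I))‖ / Real.cosh (π * t) ≤
      ∫ t : ℝ, 20 * (1 + |t|) / Real.cosh (π * t) := by
    refine integral_mono i1 hE fun t => ?_
    have hc := Real.cosh_pos (π * t)
    have a1 : ((σ + 1 : ℝ) : ℂ) + ((2 : ℝ) : ℂ) * (1 / 2 + t * I) =
        ((σ + 2 : ℝ) : ℂ) + ((2 * t : ℝ) : ℂ) * I := by push_cast; ring
    simp only
    rw [a1]
    gcongr
    refine (log_norm_riemannZeta₁_le (by linarith) (by linarith)).trans ?_
    rw [abs_mul, abs_of_pos two_pos]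
    linarith
  have hLσ := (abs_le.mp (hL σ ⟨h1, h2⟩)).1
  rw [Measure.integral_comp_mul_left] at hle
  have hinv : |(-2 : ℝ)⁻¹| = 1 / 2 := by norm_num [abs_of_neg]
  rw [hinv, smul_eq_mul] at hle
  simp only [sub_div]
  rw [integral_sub hH hGint]
  linarith

/-- Beyond height `T` the weight `1 / cosh (π t)` is smaller than `1 / cosh (π t / 2)` by the factor
`1 / cosh (π T / 2)`. -/
lemma cosh_half_mul_le {t T : ℝ} (hT : 0 ≤ T) (ht : T ≤ |t|) :
    Real.cosh (π / 2 * T) * Real.cosh (π / 2 * t) ≤ Real.cosh (π * t) := by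
  have h1 : Real.cosh (π * t) = 2 * Real.cosh (π / 2 * t) ^ 2 - 1 := by
    rw [show π * t = 2 * (π / 2 * t) by ring, Real.cosh_two_mul, Real.sinh_sq]; ring
  have h2 : Real.cosh (π / 2 * T) ≤ Real.cosh (π / 2 * t) := by
    rw [Real.cosh_le_cosh, abs_mul, abs_mul, abs_of_nonneg hT]
    gcongr
  have h3 := Real.one_le_cosh (π / 2 * t)
  rw [h1]
  nlinarith

lemma integrable_log_norm_riemannZeta₁ {σ : ℝ} (h1 : 1 / 2 ≤ σ) (h2 : σ ≤ 2) :
    Integrable fun t : ℝ => Real.log ‖riemannZeta₁ (σ + t * I)‖ / Real.cosh (π * t) := by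
  obtain ⟨K, hK⟩ := exists_zeta₁_heavy_bound
  refine (hK σ h1 h2).1.mono ?_ (Eventually.of_forall fun t => ?_)
  · have hm : Continuous fun t : ℝ => riemannZeta₁ (σ + t * I) :=
      differentiable_riemannZeta₁.continuous.comp (by fun_prop)
    exact ((Real.measurable_log.comp hm.norm.measurable).div
      (Real.continuous_cosh.comp (by fun_prop)).measurable).aestronglyMeasurable
  · rw [norm_div, norm_div, Real.norm_of_nonneg (Real.cosh_pos _).le,
      Real.norm_of_nonneg (Real.cosh_pos _).le]
    have := cosh_half_mul_le (t := t) le_rfl (abs_nonneg t)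
    rw [mul_zero, Real.cosh_zero, one_mul] at this
    have hc := Real.cosh_pos (π / 2 * t)
    gcongr

/-- Jensen's inequality in the strip `1 / 2 ≤ Re s ≤ 3 / 2`, at whose centre
`riemannZeta₁ 1 = 1`. -/
lemma zeta₁LineIntegral_ge :
    0 ≤ zeta₁LineIntegral (1 / 2) + zeta₁LineIntegral (3 / 2) := by
  have h := (zeta₁_strip_jensen (c := 1) (w := 1) zero_le_one (by norm_num) (by simp)).2.2
  rw [← zeta₁LineIntegral_neg_line (1 / 2), add_comm]
  simp only [ofReal_one, riemannZeta₁_one, norm_one, Real.log_one, mul_zero] at h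
  refine h.trans (le_of_eq ?_)
  rw [zeta₁LineIntegral]
  congr 2 with t <;> (push_cast; ring_nf)

/-- A zero in `1 / 2 < Re s < 1` makes the inequality of `zeta₁LineIntegral_ge` strict. -/
lemma zeta₁LineIntegral_pos_of_zero {ρ : ℂ} (h1 : 1 / 2 < ρ.re) (h2 : ρ.re < 1)
    (hρ : riemannZeta ρ = 0) :
    0 < zeta₁LineIntegral (1 / 2) + zeta₁LineIntegral (3 / 2) := by
  have hρ1 : ρ ≠ 1 := by rintro rfl; simp at h2
  have hz : riemannZeta₁ ρ = 0 := by
    have := riemannZeta_eq_inv_sub_mul hρ1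
    rw [hρ] at this
    exact (mul_eq_zero.mp this.symm).resolve_left (inv_ne_zero (sub_ne_zero.mpr hρ1))
  have h := strip_jensen_strict (f := fun z => riemannZeta₁ (((1 : ℝ) : ℂ) + ((1 : ℝ) : ℂ) * z))
    (C := 2 * (1 + 1 + 1)) (by norm_num) (fun z _ => analyticAt_riemannZeta₁_affine _ _ _)
    (fun z hz => riemannZeta₁_growth_affine zero_le_one hz (by norm_num)) (by simp)
    (z := ρ - 1) (by rw [abs_lt, sub_re, one_re]; constructor <;> linarith) (by simpa using hz)
  rw [← zeta₁LineIntegral_neg_line (1 / 2), add_comm]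
  simp only [ofReal_one, riemannZeta₁_one, norm_one, Real.log_one, mul_zero, add_zero] at h
  refine h.trans_le (le_of_eq ?_)
  rw [zeta₁LineIntegral]
  congr 2 with t <;> (push_cast; ring_nf)

/-! ### Continuity of the line integrals from the right -/

/-- Moving a point of a vertical line to the right cannot bring it closer to a zero on that line,
so `‖f‖` decreases by a factor close to `1` at most, even near the zeros. -/
lemma eventually_norm_line_le {f : ℂ → ℂ} (hf : ∀ z, AnalyticAt ℂ f z) {z₀ : ℂ} (hz₀ : f z₀ ≠ 0)
    (σ T : ℝ) {η : ℝ} (hη : 0 < η) :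
    ∀ᶠ ε in 𝓝[>] (0 : ℝ), ∀ t : ℝ, |t| ≤ T →
      Real.exp (-η) * ‖f (σ + t * I)‖ ≤ ‖f ((σ + ε : ℝ) + t * I)‖ := by
  have key : ∀ᶠ ε in 𝓝 (0 : ℝ), ∀ t ∈ Icc (-T) T, 0 ≤ ε →
      Real.exp (-η) * ‖f (σ + t * I)‖ ≤ ‖f ((σ + ε : ℝ) + t * I)‖ := by
    refine isCompact_Icc.eventually_forall_of_forall_eventually fun t₀ _ => ?_
    set ρ : ℂ := σ + t₀ * I with hρ
    have hnot : ¬∀ᶠ z in 𝓝 ρ, f z = 0 := by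
      intro hev
      exact hz₀ (AnalyticOnNhd.eqOn_zero_of_preconnected_of_eventuallyEq_zero
        (fun z _ => hf z) isPreconnected_univ (mem_univ ρ) hev (mem_univ z₀))
    obtain ⟨m, g, hg, hgρ, hfac⟩ := (hf ρ).exists_eventuallyEq_pow_smul_nonzero_iff.mpr hnot
    have hlog : ContinuousAt (fun z => Real.log ‖g z‖) ρ :=
      hg.continuousAt.norm.log (norm_ne_zero_iff.mpr hgρ)
    have hclose : ∀ᶠ z in 𝓝 ρ, |Real.log ‖g z‖ - Real.log ‖g ρ‖| < η / 2 := by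
      have := Metric.tendsto_nhds.mp hlog (η / 2) (by positivity)
      simpa only [Real.dist_eq] using this
    have hall := hfac.and (hclose.and (hg.continuousAt.eventually_ne hgρ))
    have c1 : Tendsto (fun p : ℝ × ℝ => (σ : ℂ) + p.2 * I) (𝓝 (0, t₀)) (𝓝 ρ) := by
      have : Continuous fun p : ℝ × ℝ => (σ : ℂ) + p.2 * I := by fun_prop
      exact this.tendsto (0, t₀)
    have c2 : Tendsto (fun p : ℝ × ℝ => ((σ + p.1 : ℝ) : ℂ) + p.2 * I) (𝓝 (0, t₀)) (𝓝 ρ) := by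
      have : Continuous fun p : ℝ × ℝ => ((σ + p.1 : ℝ) : ℂ) + p.2 * I := by fun_prop
      have h := this.tendsto (0, t₀)
      simpa [hρ] using h
    filter_upwards [c1.eventually hall, c2.eventually hall] with p h1 h2 hp
    obtain ⟨f1, l1, n1⟩ := h1
    obtain ⟨f2, l2, n2⟩ := h2
    rw [f1, f2, norm_smul, norm_smul, norm_pow, norm_pow]
    -- `ρ` lies on the line itself, so a shift to the right only adds to the distance from it
    have hdist : ‖(σ : ℂ) + p.2 * I - ρ‖ ≤ ‖((σ + p.1 : ℝ) : ℂ) + p.2 * I - ρ‖ := by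
      rw [Complex.norm_eq_sqrt_sq_add_sq, Complex.norm_eq_sqrt_sq_add_sq]
      apply Real.sqrt_le_sqrt
      simp only [hρ, sub_re, add_re, ofReal_re, re_ofReal_mul, I_re, mul_zero, add_zero, sub_im,
        add_im, ofReal_im, im_ofReal_mul, I_im, mul_one, zero_add]
      nlinarith
    have hgle : Real.exp (-η) * ‖g (σ + p.2 * I)‖ ≤ ‖g ((σ + p.1 : ℝ) + p.2 * I)‖ := by
      rw [← Real.exp_log (norm_pos_iff.mpr n1), ← Real.exp_log (norm_pos_iff.mpr n2),
        ← Real.exp_add, Real.exp_le_exp]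
      have := abs_lt.mp l1
      have := abs_lt.mp l2
      linarith
    calc Real.exp (-η) * (‖(σ : ℂ) + p.2 * I - ρ‖ ^ m * ‖g (σ + p.2 * I)‖)
        = ‖(σ : ℂ) + p.2 * I - ρ‖ ^ m * (Real.exp (-η) * ‖g (σ + p.2 * I)‖) := by ring
      _ ≤ _ := by gcongr
  filter_upwards [nhdsWithin_le_nhds key, self_mem_nhdsWithin] with ε h hε t ht
  exact h t (abs_le.mp ht) (le_of_lt hε)

lemma ae_riemannZeta₁_line_ne_zero (σ : ℝ) : ∀ᵐ t : ℝ, riemannZeta₁ (σ + t * I) ≠ 0 :=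
  ae_ne_zero_of_analytic_line isPreconnected_univ (fun z _ => analyticAt_riemannZeta₁ z)
    (mem_univ 1) (by simp) (fun _ => mem_univ _)

/-- The line integrals of `log ‖riemannZeta₁‖` are lower semicontinuous from the right. -/
lemma eventually_zeta₁LineIntegral_ge {σ : ℝ} (h1 : 1 / 2 ≤ σ) (h2 : σ ≤ 3 / 2) {τ : ℝ}
    (hτ : 0 < τ) : ∀ᶠ ε in 𝓝[>] (0 : ℝ), zeta₁LineIntegral σ - τ ≤ zeta₁LineIntegral (σ + ε) := by
  obtain ⟨K, hK⟩ := exists_zeta₁_heavy_bound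
  have hpi := Real.pi_pos
  have hk : Integrable fun t : ℝ => 1 / Real.cosh (π * t) := by
    refine (integrable_linear_div_cosh hpi 1).mono' ?_ (Eventually.of_forall fun t => ?_)
    · exact ((measurable_const).div
        (Real.continuous_cosh.comp (by fun_prop)).measurable).aestronglyMeasurable
    · have := Real.cosh_pos (π * t)
      rw [Real.norm_of_nonneg (by positivity)]
      gcongr
      linarith [abs_nonneg t]
  set A := ∫ t : ℝ, 1 / Real.cosh (π * t) with hA
  have hA0 : 0 ≤ A := integral_nonneg fun t => by
    have := Real.cosh_pos (π * t); positivity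
  set η := τ / (2 * (A + 1)) with hη
  have hηpos : 0 < η := by positivity
  have hηA : η * A ≤ τ / 2 := by
    rw [hη, div_mul_eq_mul_div, div_le_iff₀ (by positivity)]
    nlinarith
  -- beyond `T` the heavier weight leaves at most `τ / 2`
  obtain ⟨T, hT0, hT⟩ : ∃ T : ℝ, 0 ≤ T ∧ |K| / Real.cosh (π / 2 * T) ≤ τ / 2 := by
    refine ⟨2 * |K| / τ, by positivity, ?_⟩
    rw [div_le_iff₀ (Real.cosh_pos _)]
    have h3 : π / 2 * (2 * |K| / τ) ≤ Real.cosh (π / 2 * (2 * |K| / τ)) := by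
      refine (Real.self_le_sinh_iff.mpr (by positivity)).trans (Real.sinh_lt_cosh _).le
    have h4 : 2 * |K| / τ ≤ π / 2 * (2 * |K| / τ) :=
      le_mul_of_one_le_left (by positivity) (by linarith [Real.pi_gt_three])
    calc |K| = τ / 2 * (2 * |K| / τ) := by field_simp
      _ ≤ _ := by gcongr; exact h4.trans h3
  have hloc := eventually_norm_line_le analyticAt_riemannZeta₁ (z₀ := 1) (by simp) σ T hηpos
  filter_upwards [hloc, Ioo_mem_nhdsGT (show (0 : ℝ) < 1 / 2 by norm_num)] with ε hε hεI
  have hσε1 : 1 / 2 ≤ σ + ε := by linarith [hεI.1]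
  have hσε2 : σ + ε ≤ 2 := by linarith [hεI.2]
  obtain ⟨hHint, hHle⟩ := hK (σ + ε) hσε1 hσε2
  have hD := integrable_linear_div_cosh hpi 10
  have hD2 := integrable_linear_div_cosh (half_pos hpi) 10
  have i0 := integrable_log_norm_riemannZeta₁ h1 (by linarith)
  have iε := integrable_log_norm_riemannZeta₁ hσε1 hσε2
  -- subtracting `log ‖riemannZeta₁‖` from its upper bound leaves a nonnegative function, so the
  -- claim becomes an upper bound for the integral of `q (σ + ε)`
  set q : ℝ → ℝ → ℝ := fun x t => 10 * (1 + |t|) - Real.log ‖riemannZeta₁ (x + t * I)‖ with hq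
  have hq0 : ∀ t, 0 ≤ q σ t := fun t =>
    sub_nonneg.mpr (log_norm_riemannZeta₁_le h1 (by linarith))
  have hqε : ∀ t, 0 ≤ q (σ + ε) t := fun t =>
    sub_nonneg.mpr (log_norm_riemannZeta₁_le hσε1 (by linarith))
  have iq0 : Integrable fun t => q σ t / Real.cosh (π * t) := by
    simpa only [hq, sub_div, Pi.sub_def] using hD.sub i0
  have iqε : Integrable fun t => q (σ + ε) t / Real.cosh (π * t) := by
    simpa only [hq, sub_div, Pi.sub_def] using hD.sub iε
  have iqH : Integrable fun t => q (σ + ε) t / Real.cosh (π / 2 * t) := by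
    simpa only [hq, sub_div, Pi.sub_def] using hD2.sub hHint
  have hmono : ∫ t, q (σ + ε) t / Real.cosh (π * t) ≤
      ∫ t, (q σ t / Real.cosh (π * t) + η * (1 / Real.cosh (π * t)) +
        1 / Real.cosh (π / 2 * T) * (q (σ + ε) t / Real.cosh (π / 2 * t))) := by
    refine integral_mono_ae iqε ((iq0.add (hk.const_mul η)).add (iqH.const_mul _)) ?_
    filter_upwards [ae_riemannZeta₁_line_ne_zero σ] with t ht
    have hc1 := Real.cosh_pos (π * t)
    have hc2 := Real.cosh_pos (π / 2 * t)
    have hc3 := Real.cosh_pos (π / 2 * T)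
    have p1 : 0 ≤ q σ t / Real.cosh (π * t) := div_nonneg (hq0 t) hc1.le
    have p3 : 0 ≤ 1 / Real.cosh (π / 2 * T) * (q (σ + ε) t / Real.cosh (π / 2 * t)) :=
      mul_nonneg (by positivity) (div_nonneg (hqε t) hc2.le)
    have p2 : 0 ≤ η * (1 / Real.cosh (π * t)) := by positivity
    -- local comparison up to height `T`, comparison of the two weights above it
    rcases le_or_gt |t| T with htT | htT
    · have hle := Real.log_le_log (mul_pos (Real.exp_pos _) (norm_pos_iff.mpr ht)) (hε t htT)
      rw [Real.log_mul (Real.exp_pos _).ne' (norm_ne_zero_iff.mpr ht), Real.log_exp] at hle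
      have : q (σ + ε) t / Real.cosh (π * t) ≤ q σ t / Real.cosh (π * t) +
          η * (1 / Real.cosh (π * t)) := by
        rw [mul_one_div, ← add_div]
        gcongr
        simp only [hq]
        linarith
      linarith
    · have : q (σ + ε) t / Real.cosh (π * t) ≤
          1 / Real.cosh (π / 2 * T) * (q (σ + ε) t / Real.cosh (π / 2 * t)) := by
        rw [div_mul_div_comm, one_mul]
        exact div_le_div_of_nonneg_left (hqε t) (by positivity) (cosh_half_mul_le hT0 htT.le)
      linarith
  have e0 : ∫ t, q σ t / Real.cosh (π * t) =
      (∫ t : ℝ, 10 * (1 + |t|) / Real.cosh (π * t)) - zeta₁LineIntegral σ := by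
    simp only [hq, sub_div]
    exact integral_sub hD i0
  have eε : ∫ t, q (σ + ε) t / Real.cosh (π * t) =
      (∫ t : ℝ, 10 * (1 + |t|) / Real.cosh (π * t)) - zeta₁LineIntegral (σ + ε) := by
    simp only [hq, sub_div]
    exact integral_sub hD iε
  have hsum : ∫ t, (q σ t / Real.cosh (π * t) + η * (1 / Real.cosh (π * t)) +
        1 / Real.cosh (π / 2 * T) * (q (σ + ε) t / Real.cosh (π / 2 * t))) =
      (∫ t, q σ t / Real.cosh (π * t)) + η * A +
        1 / Real.cosh (π / 2 * T) * ∫ t, q (σ + ε) t / Real.cosh (π / 2 * t) := by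
    have e := integral_add (iq0.add (hk.const_mul η))
      (iqH.const_mul (1 / Real.cosh (π / 2 * T)))
    simp only [Pi.add_apply] at e
    rw [e, integral_add iq0 (hk.const_mul η), integral_const_mul, integral_const_mul]
  have hlast : 1 / Real.cosh (π / 2 * T) * ∫ t, q (σ + ε) t / Real.cosh (π / 2 * t) ≤ τ / 2 := by
    refine le_trans ?_ hT
    rw [div_mul_eq_mul_div, one_mul]
    have hc3 := Real.cosh_pos (π / 2 * T)
    gcongr
    exact hHle.trans (le_abs_self K)
  rw [hsum, e0, eε] at hmono
  linarith

/-! ### The zero-free case -/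

/-- A zero-free holomorphic function on a disc has a holomorphic logarithm there. -/
lemma exists_log_on_ball {G : ℂ → ℂ} {R : ℝ} (hR : 0 < R) (hG : Differentiable ℂ G)
    (hne : ∀ w ∈ ball (0 : ℂ) R, G w ≠ 0) (h0 : G 0 = 1) :
    ∃ g : ℂ → ℂ, DifferentiableOn ℂ g (ball 0 R) ∧ g 0 = 0 ∧
      ∀ w ∈ ball (0 : ℂ) R, exp (g w) = G w := by
  have hq : DifferentiableOn ℂ (fun w => deriv G w / G w) (ball 0 R) := fun w hw =>
    ((hG.deriv w).div (hG w) (hne w hw)).differentiableWithinAt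
  obtain ⟨g, hg0, hg⟩ := hq.isExactOn_ball.with_val_at 0 0
  have hgd : DifferentiableOn ℂ g (ball 0 R) := fun w hw =>
    (hg w hw).differentiableAt.differentiableWithinAt
  refine ⟨g, hgd, hg0, fun w hw => ?_⟩
  have hderiv : ∀ z ∈ ball (0 : ℂ) R, HasDerivAt (fun z => G z * exp (-g z)) 0 z := by
    intro z hz
    have h1 := (hG z).hasDerivAt.mul ((hg z hz).neg.cexp)
    refine h1.congr_deriv ?_
    have := hne z hz
    field_simp
    ring
  have hconst := isOpen_ball.is_const_of_deriv_eq_zero (convex_ball (0 : ℂ) R).isPreconnected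
    (f := fun z => G z * exp (-g z))
    (fun z hz => (hderiv z hz).differentiableAt.differentiableWithinAt)
    (fun z hz => (hderiv z hz).deriv) hw (mem_ball_self hR)
  simp only [hg0, h0, neg_zero, Complex.exp_zero, mul_one] at hconst
  rw [Complex.exp_neg, ← div_eq_mul_inv, div_eq_one_iff_eq (exp_ne_zero _)] at hconst
  exact hconst.symm

/-- If `ζ` has no zeros with real part greater than `1 / 2`, the Borel–Carathéodory theorem on the
discs of radius `2` touching the critical line bounds `log ‖riemannZeta₁‖` from below. -/
lemma exists_inv_riemannZeta₁_growth (hne : ∀ s : ℂ, 1 / 2 < s.re → riemannZeta₁ s ≠ 0) {ε : ℝ}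
    (hε : 0 < ε) : ∃ C : ℝ, 0 ≤ C ∧ ∀ s : ℂ, 1 / 2 + ε ≤ s.re → s.re ≤ 5 / 2 →
      ‖(riemannZeta₁ s)⁻¹‖ ≤ Real.exp (C * (1 + |s.im|)) := by
  obtain ⟨K, hK, hζ⟩ := exists_norm_riemannZeta_le
  refine ⟨4 * (13 + K) / ε + K, by positivity, fun s hs1 hs2 => ?_⟩
  set c : ℂ := ((5 / 2 : ℝ) : ℂ) + s.im * I with hc
  have hcre : c.re = 5 / 2 := by simp [hc]
  have hcnorm : ‖c‖ ≤ 5 / 2 + |s.im| := by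
    refine (norm_add_le _ _).trans ?_
    rw [norm_mul, norm_I, mul_one, norm_real, norm_real, Real.norm_eq_abs, Real.norm_eq_abs,
      abs_of_pos (by norm_num : (0 : ℝ) < 5 / 2)]
  have hc1 : c ≠ 1 := by intro h; rw [h, one_re] at hcre; norm_num at hcre
  have hFc : riemannZeta₁ c ≠ 0 := hne c (by rw [hcre]; norm_num)
  -- the value at the centre of the disc is bounded away from zero
  have hcentre : -Real.log ‖riemannZeta₁ c‖ ≤ K := by
    have h1 := (hζ c (by rw [hcre]; norm_num)).2
    have h2 : ‖(riemannZeta₁ c)⁻¹‖ ≤ 1 + K := by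
      have h3 : (riemannZeta₁ c)⁻¹ = (riemannZeta c)⁻¹ * (c - 1)⁻¹ := by
        rw [riemannZeta_eq_inv_sub_mul hc1, mul_inv, inv_inv]
        have := sub_ne_zero.mpr hc1
        field_simp
      have h4 : 1 ≤ ‖c - 1‖ := by
        refine le_trans ?_ (abs_re_le_norm (c - 1))
        rw [sub_re, hcre, one_re]; norm_num [abs_of_pos]
      have h5 : (2 : ℝ) ^ (-c.re) ≤ 1 :=
        Real.rpow_le_one_of_one_le_of_nonpos one_le_two (by rw [hcre]; norm_num)
      rw [h3, norm_mul, norm_inv (c - 1)]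
      calc ‖(riemannZeta c)⁻¹‖ * ‖c - 1‖⁻¹ ≤ (1 + K * 2 ^ (-c.re)) * 1 := by
            gcongr
            exact inv_le_one_of_one_le₀ h4
        _ ≤ 1 + K := by nlinarith
    have h6 := Real.log_le_log (norm_pos_iff.mpr (inv_ne_zero hFc)) h2
    rw [norm_inv, Real.log_inv] at h6
    linarith [Real.log_le_sub_one_of_pos (show 0 < 1 + K by linarith)]
  set G : ℂ → ℂ := fun w => riemannZeta₁ (c + w) / riemannZeta₁ c with hG
  have hGd : Differentiable ℂ G := by
    have : Differentiable ℂ fun w => riemannZeta₁ (c + w) :=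
      differentiable_riemannZeta₁.comp (by fun_prop)
    exact this.div_const _
  have hball : ∀ w ∈ ball (0 : ℂ) 2, 1 / 2 < (c + w).re := by
    intro w hw
    rw [mem_ball_zero_iff] at hw
    have h2 := (abs_lt.mp ((abs_re_le_norm w).trans_lt hw)).1
    rw [add_re, hcre]; linarith
  obtain ⟨g, hgd, hg0, hgexp⟩ := exists_log_on_ball two_pos hGd
    (fun w hw => div_ne_zero (hne _ (hball w hw)) hFc) (by simp [hG, hFc])
  have hre : ∀ w ∈ ball (0 : ℂ) 2, (g w).re =
      Real.log ‖riemannZeta₁ (c + w)‖ - Real.log ‖riemannZeta₁ c‖ := by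
    intro w hw
    have h1 := congrArg (fun z => Real.log ‖z‖) (hgexp w hw)
    simp only [norm_exp, Real.log_exp, hG, norm_div] at h1
    rw [h1, Real.log_div (norm_ne_zero_iff.mpr (hne _ (hball w hw))) (norm_ne_zero_iff.mpr hFc)]
  set M : ℝ := (13 + K) * (1 + |s.im|) with hM
  have hMpos : 0 < M := by positivity
  have hmaps : MapsTo g (ball 0 2) {z | z.re ≤ M} := by
    intro w hw
    change (g w).re ≤ M
    have hw2 := mem_ball_zero_iff.mp hw
    have h1 := log_norm_le_of_norm_le_exp (by positivity) (norm_riemannZeta₁_le (hball w hw).le)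
    have h2 : ‖c + w‖ ≤ 5 / 2 + |s.im| + 2 := (norm_add_le _ _).trans (by linarith)
    rw [hre w hw, hM]
    nlinarith [abs_nonneg s.im, mul_nonneg hK (abs_nonneg s.im)]
  have hsw : c + (s - c) = s := by ring
  have hswnorm : ‖s - c‖ ≤ 2 - ε := by
    have : s - c = ((s.re - 5 / 2 : ℝ) : ℂ) := by
      apply Complex.ext <;> simp [hc]
    rw [this, norm_real, Real.norm_eq_abs, abs_le]
    constructor <;> linarith
  have hsball : s - c ∈ ball (0 : ℂ) 2 := by rw [mem_ball_zero_iff]; linarith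
  -- `s` is at distance at most `2 - ε` from the centre of a disc of radius `2`
  have hbc := borelCaratheodory_zero hMpos hgd hmaps two_pos hsball hg0
  have hbc2 : ‖g (s - c)‖ ≤ 4 * M / ε := by
    refine hbc.trans ?_
    have h1 : 2 * M * ‖s - c‖ ≤ 4 * M := by nlinarith [norm_nonneg (s - c)]
    have h2 : ε ≤ 2 - ‖s - c‖ := by linarith
    gcongr
  have hre' := hre _ hsball
  rw [hsw] at hre'
  have h3 := (abs_le.mp (abs_re_le_norm (g (s - c)))).1
  have hFs : riemannZeta₁ s ≠ 0 := hne s (by linarith)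
  rw [← Real.log_le_iff_le_exp (norm_pos_iff.mpr (inv_ne_zero hFs)), norm_inv, Real.log_inv]
  have h4 : (4 * (13 + K) / ε + K) * (1 + |s.im|) = 4 * M / ε + K * (1 + |s.im|) := by
    rw [hM]; ring
  rw [h4]
  nlinarith [mul_nonneg hK (abs_nonneg s.im)]

/-- Jensen's inequality for `1 / riemannZeta₁` in the strip `1 / 2 + ε ≤ Re s ≤ 3 / 2 + ε`. -/
lemma zeta₁LineIntegral_add_le (hne : ∀ s : ℂ, 1 / 2 < s.re → riemannZeta₁ s ≠ 0) {ε : ℝ}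
    (hε : 0 < ε) (hε1 : ε ≤ 1) :
    zeta₁LineIntegral (1 / 2 + ε) + zeta₁LineIntegral (3 / 2 + ε) ≤
      2 * Real.log ‖riemannZeta₁ ((1 + ε : ℝ) : ℂ)‖ := by
  obtain ⟨C, hC, hgr⟩ := exists_inv_riemannZeta₁_growth hne hε
  have hre : ∀ z : ℂ, (((1 + ε : ℝ) : ℂ) + z).re = 1 + ε + z.re := fun z => by simp
  have him : ∀ z : ℂ, (((1 + ε : ℝ) : ℂ) + z).im = z.im := fun z => by simp
  have hne' : ∀ z : ℂ, |z.re| ≤ 1 / 2 → riemannZeta₁ (((1 + ε : ℝ) : ℂ) + z) ≠ 0 := by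
    intro z hz
    exact hne _ (by rw [hre]; linarith [(abs_le.mp hz).1])
  have h := (strip_jensen (f := fun z => (riemannZeta₁ (((1 + ε : ℝ) : ℂ) + z))⁻¹) hC
    (fun z hz => ((analyticAt_riemannZeta₁ _).comp_of_eq (by fun_prop) rfl).inv (hne' z hz))
    (fun z hz => by
      have := hgr (((1 + ε : ℝ) : ℂ) + z) (by rw [hre]; linarith [(abs_le.mp hz).1])
        (by rw [hre]; linarith [(abs_le.mp hz).2])
      rwa [him] at this)
    (inv_ne_zero (hne' 0 (by simp)))).2.2
  simp only [norm_inv, Real.log_inv, neg_div, integral_neg, add_zero] at h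
  rw [← zeta₁LineIntegral_neg_line (1 / 2 + ε), zeta₁LineIntegral]
  have e1 : ∀ t : ℝ, ((1 + ε : ℝ) : ℂ) + (1 / 2 + t * I) = ((3 / 2 + ε : ℝ) : ℂ) + t * I := by
    intro t; push_cast; ring
  have e2 : ∀ t : ℝ, ((1 + ε : ℝ) : ℂ) + -(1 / 2 + t * I) = ((1 / 2 + ε : ℝ) : ℂ) - t * I := by
    intro t; push_cast; ring
  simp only [e1, e2] at h
  linarith

/-- Without zeros to the right of the critical line, the strips `1 / 2 + ε ≤ Re s ≤ 3 / 2 + ε`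
give the reverse of `zeta₁LineIntegral_ge` as `ε → 0`. -/
lemma zeta₁LineIntegral_le (hne : ∀ s : ℂ, 1 / 2 < s.re → riemannZeta₁ s ≠ 0) :
    zeta₁LineIntegral (1 / 2) + zeta₁LineIntegral (3 / 2) ≤ 0 := by
  refine le_of_forall_pos_le_add fun τ hτ => ?_
  have h1 := eventually_zeta₁LineIntegral_ge (σ := 1 / 2) le_rfl (by norm_num) (half_pos hτ)
  have h2 := eventually_zeta₁LineIntegral_ge (σ := 3 / 2) (by norm_num) le_rfl (half_pos hτ)
  have hlim : Tendsto (fun ε : ℝ => 2 * Real.log ‖riemannZeta₁ ((1 + ε : ℝ) : ℂ)‖ + τ) (𝓝[>] 0)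
      (𝓝 (0 + τ)) := by
    have hc : Tendsto (fun ε : ℝ => ‖riemannZeta₁ ((1 + ε : ℝ) : ℂ)‖) (𝓝 0) (𝓝 1) := by
      have : Continuous fun ε : ℝ => ‖riemannZeta₁ ((1 + ε : ℝ) : ℂ)‖ :=
        (differentiable_riemannZeta₁.continuous.comp (by fun_prop)).norm
      simpa using this.tendsto 0
    have := ((hc.log one_ne_zero).const_mul 2).add_const τ
    rw [Real.log_one, mul_zero] at this
    exact this.mono_left nhdsWithin_le_nhds
  refine ge_of_tendsto hlim ?_
  filter_upwards [h1, h2, Ioo_mem_nhdsGT (zero_lt_one : (0 : ℝ) < 1)] with ε e1 e2 hε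
  linarith [zeta₁LineIntegral_add_le hne hε.1 hε.2.le]

/-! ### The criterion -/

/-- The functional equation reflects a zero off the critical line into its right half, unless it is
a trivial one. -/
lemma zero_right_of_critical_line (h : ¬RiemannHypothesis) :
    ∃ ρ : ℂ, 1 / 2 < ρ.re ∧ ρ.re < 1 ∧ riemannZeta ρ = 0 := by
  unfold RiemannHypothesis at h
  push Not at h
  obtain ⟨ρ, hρ, htriv, hρ1, hre⟩ := h
  have hlt : ∀ {s : ℂ}, riemannZeta s = 0 → s.re < 1 := fun hs => by
    by_contra! h
    exact riemannZeta_ne_zero_of_one_le_re h hs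
  rcases lt_or_gt_of_ne hre with hlow | hhigh
  · -- reflect the zero in the critical line
    have hρ0 : ρ ≠ 0 := by
      rintro rfl
      rw [riemannZeta_zero] at hρ
      norm_num at hρ
    have hs : 1 / 2 < (1 - ρ).re := by rw [sub_re, one_re]; linarith
    have hfe := riemannZeta_one_sub (s := 1 - ρ)
      (fun n hn => by
        rw [hn] at hs
        simp only [neg_re, natCast_re] at hs
        linarith [n.cast_nonneg (α := ℝ)])
      (fun h => hρ0 (by simpa using h))
    rw [sub_sub_cancel, hρ] at hfe
    have hΓ : Gamma (1 - ρ) ≠ 0 := Gamma_ne_zero_of_re_pos (by linarith)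
    have hpow : (2 * π : ℂ) ^ (-(1 - ρ)) ≠ 0 := by
      rw [cpow_ne_zero_iff_of_exponent_ne_zero]
      · simp
      · intro h
        rw [neg_eq_zero] at h
        rw [h] at hs; norm_num at hs
    have hprod : cos (π * (1 - ρ) / 2) = 0 ∨ riemannZeta (1 - ρ) = 0 := by
      have := hfe.symm
      simpa [hΓ, hpow] using this
    rcases hprod with hcos | hζ
    · -- the zeros of the cosine are the trivial zeros of `ζ`
      exfalso
      rw [Complex.cos_eq_zero_iff] at hcos
      obtain ⟨k, hk⟩ := hcos
      have hpi : (π : ℂ) ≠ 0 := by exact_mod_cast Real.pi_ne_zero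
      have hk2 : ρ = -2 * k := by
        field_simp at hk
        linear_combination -hk
      have hkpos : 1 ≤ k := by
        have h1 : ρ.re = -2 * k := by rw [hk2]; simp
        rw [h1] at hlow
        have h2 : (-1 : ℝ) < k := by linarith
        have h3 : (-1 : ℤ) < k := by exact_mod_cast h2
        have h4 : k ≠ 0 := by rintro rfl; exact hρ0 (by simpa using hk2)
        omega
      refine htriv (k - 1).toNat ?_
      have h5 : (((k - 1).toNat : ℤ) : ℂ) = ((k - 1 : ℤ) : ℂ) := by
        rw [Int.toNat_of_nonneg (by omega)]
      rw [Int.cast_natCast] at h5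
      rw [h5, hk2]
      push_cast
      ring
    · exact ⟨1 - ρ, hs, hlt hζ, hζ⟩
  · exact ⟨ρ, hhigh, hlt hρ, hρ⟩

lemma zeta₁LineIntegral_add_eq_zero_iff :
    zeta₁LineIntegral (1 / 2) + zeta₁LineIntegral (3 / 2) = 0 ↔ RiemannHypothesis := by
  constructor
  · intro h
    by_contra hRH
    obtain ⟨ρ, h1, h2, h3⟩ := zero_right_of_critical_line hRH
    exact (zeta₁LineIntegral_pos_of_zero h1 h2 h3).ne' h
  · intro hRH
    refine le_antisymm (zeta₁LineIntegral_le fun s hs => ?_) zeta₁LineIntegral_ge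
    rcases eq_or_ne s 1 with rfl | hs1
    · simp
    intro h0
    have hζ : riemannZeta s = 0 := by rw [riemannZeta_eq_inv_sub_mul hs1, h0, mul_zero]
    have := hRH s hζ (fun ⟨n, hn⟩ => by
      have h1 : s.re = -2 * (n + 1) := by rw [hn]; simp
      linarith [n.cast_nonneg (α := ℝ)]) hs1
    linarith

lemma log_norm_riemannZeta_eq {s : ℂ} (hs1 : s ≠ 1) (hs : riemannZeta₁ s ≠ 0) :
    Real.log ‖riemannZeta s‖ = Real.log ‖riemannZeta₁ s‖ - Real.log ‖s - 1‖ := by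
  rw [riemannZeta_eq_inv_sub_mul hs1, norm_mul, norm_inv, Real.log_mul
    (inv_ne_zero (norm_ne_zero_iff.mpr (sub_ne_zero.mpr hs1))) (norm_ne_zero_iff.mpr hs),
    Real.log_inv]
  ring

/-- On the lines `Re s = 1 / 2` and `Re s = 3 / 2` the factor `s - 1` has the same modulus
`‖1 / 2 + i t‖`. -/
lemma zetaLineIntegral_eq {σ : ℝ} (hσ : |σ - 1| = 1 / 2) :
    Integrable (fun t : ℝ => Real.log ‖riemannZeta (σ + t * I)‖ / Real.cosh (π * t)) ∧
    zetaLineIntegral σ = zeta₁LineIntegral σ + Real.log (π / 2) := by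
  obtain ⟨i1, h1⟩ := integral_log_norm_half_line
  obtain ⟨b1, b2⟩ := abs_le.mp hσ.le
  have i2 := integrable_log_norm_riemannZeta₁ (σ := σ) (by linarith) (by linarith)
  have hnorm : ∀ t : ℝ, ‖(σ : ℂ) + t * I - 1‖ = ‖(1 / 2 + t * I : ℂ)‖ := by
    intro t
    rw [Complex.norm_eq_sqrt_sq_add_sq, Complex.norm_eq_sqrt_sq_add_sq]
    congr 1
    have h2 : (σ - 1) ^ 2 = (1 / 2) ^ 2 := by rw [← sq_abs, hσ]
    simp
    linarith
  have hae : (fun t : ℝ => Real.log ‖riemannZeta₁ (σ + t * I)‖ / Real.cosh (π * t) -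
      Real.log ‖(1 / 2 + t * I : ℂ)‖ / Real.cosh (π * t)) =ᵐ[volume]
      fun t : ℝ => Real.log ‖riemannZeta (σ + t * I)‖ / Real.cosh (π * t) := by
    filter_upwards [ae_riemannZeta₁_line_ne_zero σ] with t ht
    have hs1 : (σ : ℂ) + t * I ≠ 1 := by
      intro h
      have h3 := congrArg re h
      simp at h3
      rw [h3] at hσ
      norm_num at hσ
    rw [log_norm_riemannZeta_eq hs1 ht, hnorm, sub_div]
  refine ⟨(i2.sub i1).congr hae, ?_⟩
  rw [zetaLineIntegral, ← integral_congr_ae hae, integral_sub i2 i1, h1, zeta₁LineIntegral]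
  ring

/-- The integrand is even, because `ζ` commutes with conjugation. -/
lemma two_mul_integral_Ioi_critical_line :
    2 * ∫ t in Ioi (0 : ℝ), Real.log ‖riemannZeta (1 / 2 + t * I)‖ / Real.cosh (π * t) =
      zetaLineIntegral (1 / 2) := by
  have h := integral_comp_abs (f := fun t : ℝ =>
    Real.log ‖riemannZeta (1 / 2 + t * I)‖ / Real.cosh (π * t))
  rw [← h, zetaLineIntegral]
  congr 1 with t
  rcases abs_choice t with ht | ht
  · rw [ht]; push_cast; rfl
  · rw [ht, mul_neg, Real.cosh_neg, ← norm_riemannZeta_neg_im]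
    push_cast
    rw [neg_mul, ← sub_eq_add_neg]

theorem mainTheorem2 :
    MeasureTheory.IntegrableOn
      (fun t : ℝ => Real.log ‖riemannZeta (1 / 2 + (t : ℂ) * Complex.I)‖ / Real.cosh (Real.pi * t))
      (Set.Ioi 0) MeasureTheory.volume ∧
    Summable (fun n : ℕ =>
      (-1 : ℝ) ^ ((n + 2) + 1) * Real.log (riemannZeta ((n + 2 : ℕ) : ℂ)).re) ∧
    ((∫ t in Set.Ioi (0 : ℝ),
        Real.log ‖riemannZeta (1 / 2 + (t : ℂ) * Complex.I)‖ / Real.cosh (Real.pi * t)) =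
        Real.log (Real.pi / 2) +
          ∑' n : ℕ, (-1 : ℝ) ^ ((n + 2) + 1) * Real.log (riemannZeta ((n + 2 : ℕ) : ℂ)).re
      ↔ RiemannHypothesis) := by
  obtain ⟨i1, h1⟩ := zetaLineIntegral_eq (σ := 1 / 2) (by norm_num [abs_of_neg])
  obtain ⟨-, h2⟩ := zetaLineIntegral_eq (σ := 3 / 2) (by norm_num [abs_of_pos])
  refine ⟨?_, summable_log_riemannZeta, ?_⟩
  · push_cast at i1
    exact i1.integrableOn
  · rw [← zeta₁LineIntegral_add_eq_zero_iff]
    have h3 := two_mul_integral_Ioi_critical_line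
    have h4 := two_mul_tsum_log_riemannZeta
    constructor <;> intro h <;> linarith
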